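/- Let $\mathcal I$ be a countable cancellative commutative semiring with a parity function, i.e. a non-trivial homomorphism $p:(\mathcal I,+)\to\mathbb Z_2$. For a finite-dimensional real $\mathcal I$-graded vector space $V=\bigoplus_i V_i$ with $V_0=0$, let $\mathrm S(V)$ be the tensor algebra of $V$ modulo the relations $v\otimes w=(-1)^{p(ij)}w\otimes v$ ($v\in V_i$, $w\in V_j$), and let $\overline{\mathrm S(V)}=\prod_{n\ge 0}\mathrm S^n(V)$. An $\mathcal I$-graded ringed space is a topological space with a sheaf of real $\mathcal I$-graded algebras whose restrictions preserve the grading. (As $\overline{\mathrm S(V)}$ may have infinitely many homogeneous components, an $\mathcal I$-grading of $A$ is understood as $\bigoplus_i A_i\subseteq A\subseteq\prod_i A_i$.) A morphism $\varphi=(\tilde\varphi,\varphi^*)$ is a morphism of ringed spaces for which $\varphi^*$ preserves the grading. An $\mathcal I$-graded domain is an open set $U\subseteq\mathbb R^n$ with the sheaf of $\overline{\mathrm S(V)}$-valued smooth functions; its canonical body map $\epsilon$ to the sheaf $C^\infty$ of smooth real functions is the projection to $\mathrm S^0(V)=\mathbb R$. An $\mathcal I$-graded manifold $\mathcal M=(M,\mathcal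 O_M)$ is a Hausdorff smooth manifold $M$ with a sheaf $\mathcal O_M$ that makes it an $\mathcal I$-graded ringed space locally isomorphic, over diffeomorphisms, to $\mathcal I$-graded domains of a fixed dimension $n|(\dim V_i)$; these isomorphisms are its charts. A smooth manifold with $C^\infty$ in degree $0$ is regarded as an $\mathcal I$-graded ringed space, and a morphism $\mathcal O_M\to C^\infty$ of sheaves of $\mathcal I$-graded rings on $M$ as a morphism $M\to\mathcal M$ that is the identity on $M$. **Proposition.** Let $\mathcal M=(M,\mathcal O_M)$ and $\mathcal N=(N,\mathcal O_N)$ be $\mathcal I$-graded manifolds. On each of them there is exactly one morphism of sheaves of $\mathcal I$-graded rings $\epsilon:\mathcal O\to C^\infty$ (the body map), and in every chart it is the canonical one. 1. For every morphism $\varphi=(\tilde\varphi,\varphi^*):\mathcal M\to\mathcal N$, every open $U\subseteq N$ and every $f\in\mathcal O_N(U)$, $$\epsilon(\varphi^*f)=\epsilon(f)\circ\tilde\varphi\quad\text{on }\tilde\varphi^{-1}(U).$$ Moreover $\tilde\varphi:M\to N$ is smooth, and $\varphi$ restricts to it on underlying manifolds: the composites $M\hookrightarrow\mathcal M\xrightarrow{\varphi}\mathcal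 N$ and $M\xrightarrow{\tilde\varphi}N\hookrightarrow\mathcal N$ are equal, where the inclusions are given by the body maps. 2. $\tilde\varphi$ is determined by $\varphi^*$: if two morphisms $\varphi,\psi:\mathcal M\to\mathcal N$ have the same pullback of global sections $\mathcal O_N(N)\to\mathcal O_M(M)$, then $\tilde\varphi=\tilde\psi$. In particular, 1 and 2 hold for morphisms of $\mathcal I$-graded domains with their canonical body maps. -/

import Mathlib

open TopologicalSpace Opposite CategoryTheory
open scoped Manifold ContDiff

noncomputable section

namespace MonoidallyGraded

universe u v w u₁ u₂ v₁ v₂ w₁ w₂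

/-! ### Graded vector spaces and graded algebras -/

/-- A finite-dimensional real `I`-graded vector space `V = ⨁ i, V i` with `V 0 = 0`
(that is, all `V i` are finite-dimensional and only finitely many are non-zero). -/
structure GradedVectorSpace (I : Type u) [Zero I] where
  carrier : Type v
  [addCommGroup : AddCommGroup carrier]
  [module : Module ℝ carrier]
  [finiteDimensional : FiniteDimensional ℝ carrier]
  grade : I → Submodule ℝ carrier
  independent : iSupIndep grade
  spans : iSup grade = ⊤
  grade_zero : grade 0 = ⊥

attribute [instance] GradedVectorSpace.addCommGroup GradedVectorSpace.module
  GradedVectorSpace.finiteDimensional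

/-- `𝒜` is an `I`-grading of the real algebra `A`: it is multiplicative and every element is
determined by its homogeneous components, i.e. `⨁ i, 𝒜 i ⊆ A ⊆ ∏ i, 𝒜 i`.
Algebras of formal power series have infinitely many non-zero homogeneous components
in general, so that `A = ⨁ i, 𝒜 i` cannot be asked for. -/
structure IsGrading {I : Type u} [AddMonoid I] {A : Type v} [Ring A] [Algebra ℝ A]
    (𝒜 : I → Submodule ℝ A) : Prop where
  one_mem : (1 : A) ∈ 𝒜 0
  mul_mem : ∀ {i j : I} {a b : A}, a ∈ 𝒜 i → b ∈ 𝒜 j → a * b ∈ 𝒜 (i + j)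
  exists_proj : ∃ π : I → A →ₗ[ℝ] A,
    (∀ i a, π i a ∈ 𝒜 i) ∧ (∀ i, ∀ a ∈ 𝒜 i, π i a = a) ∧
      (∀ i j, i ≠ j → ∀ a ∈ 𝒜 j, π i a = 0) ∧ ∀ a, (∀ i, π i a = 0) → a = 0

/-! ### The symmetric algebra and its formal completion -/

section Algebra

variable {I : Type u} [NonUnitalCommSemiring I]

/-- The sign `(-1) ^ p(ij)`. -/
def koszulSign (p : I →+ ZMod 2) (i j : I) : ℝ := if p (i * j) = 0 then 1 else -1

/-- The relations `v ⊗ w = (-1) ^ p(ij) w ⊗ v` for `v`, `w` homogeneous of degrees `i`, `j`. -/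
inductive SymRel (p : I →+ ZMod 2) (V : GradedVectorSpace.{u, v} I) :
    TensorAlgebra ℝ V.carrier → TensorAlgebra ℝ V.carrier → Prop
  | comm {i j : I} {x y : V.carrier} (hx : x ∈ V.grade i) (hy : y ∈ V.grade j) :
      SymRel p V (TensorAlgebra.ι ℝ x * TensorAlgebra.ι ℝ y)
        (koszulSign p i j • (TensorAlgebra.ι ℝ y * TensorAlgebra.ι ℝ x))

/-- The symmetric algebra `S(V)` of a graded vector space. -/
def Sym (p : I →+ ZMod 2) (V : GradedVectorSpace.{u, v} I) : Type v := RingQuot (SymRel p V)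

variable (p : I →+ ZMod 2) (V : GradedVectorSpace.{u, v} I)

instance : Ring (Sym p V) := inferInstanceAs (Ring (RingQuot (SymRel p V)))

instance : Algebra ℝ (Sym p V) := inferInstanceAs (Algebra ℝ (RingQuot (SymRel p V)))

/-- The projection of the tensor algebra onto the symmetric algebra. -/
def Sym.mk : TensorAlgebra ℝ V.carrier →ₐ[ℝ] Sym p V := RingQuot.mkAlgHom ℝ (SymRel p V)

variable {p V} in
/-- The universal property of the symmetric algebra as a quotient of the tensor algebra. -/
def Sym.lift {B : Type w} [Ring B] [Algebra ℝ B] (f : TensorAlgebra ℝ V.carrier →ₐ[ℝ] B)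
    (hf : ∀ ⦃x y⦄, SymRel p V x y → f x = f y) : Sym p V →ₐ[ℝ] B :=
  RingQuot.liftAlgHom ℝ ⟨f, hf⟩

theorem Sym.lift_mk {B : Type w} [Ring B] [Algebra ℝ B] (f : TensorAlgebra ℝ V.carrier →ₐ[ℝ] B)
    (hf : ∀ ⦃x y⦄, SymRel p V x y → f x = f y) (t : TensorAlgebra ℝ V.carrier) :
    Sym.lift f hf (Sym.mk p V t) = f t :=
  RingQuot.liftAlgHom_mkAlgHom_apply ℝ f hf t

/-- The canonical map `V → S(V)`. -/
def Sym.gen : V.carrier →ₗ[ℝ] Sym p V :=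
  (Sym.mk p V).toLinearMap ∘ₗ TensorAlgebra.ι ℝ

/-- `Sⁿ(V)`, spanned by the products of `n` elements of `V`. -/
def Sym.power (n : ℕ) : Submodule ℝ (Sym p V) := LinearMap.range (Sym.gen p V) ^ n

/-- `S(V)ₖ`, spanned by the products of homogeneous elements of `V` whose degrees add up
to `k`. -/
def Sym.homog (k : I) : Submodule ℝ (Sym p V) :=
  Submodule.span ℝ {s | ∃ l : List (I × V.carrier), (∀ q ∈ l, q.2 ∈ V.grade q.1) ∧
    (l.map Prod.fst).sum = k ∧ s = (l.map fun q => Sym.gen p V q.2).prod}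

/-- The algebra homomorphism `S(V) → ℝ` induced by the zero map `V → ℝ`. -/
def Sym.aug : Sym p V →ₐ[ℝ] ℝ :=
  Sym.lift (TensorAlgebra.lift ℝ (0 : V.carrier →ₗ[ℝ] ℝ)) (by
    rintro _ _ ⟨hx, hy⟩
    simp)

/-- The algebra `∏ n, Sⁿ(V)` of formal power series on `V`. The family `(fₙ)` is written as the
power series `∑ fₙ Tⁿ` in a central auxiliary variable `T`, so that the multiplication is
`(fg)ₙ = ∑ fᵢ gⱼ` over `i + j = n`. -/
def Formal : Subalgebra ℝ (PowerSeries (Sym p V)) where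
  carrier := {f | ∀ n, PowerSeries.coeff n f ∈ Sym.power p V n}
  add_mem' hf hg n := by
    rw [map_add]
    exact add_mem (hf n) (hg n)
  mul_mem' hf hg n := by
    rw [PowerSeries.coeff_mul]
    refine Submodule.sum_mem _ fun q hq => ?_
    rw [← Finset.HasAntidiagonal.mem_antidiagonal.mp hq, Sym.power, pow_add]
    exact Submodule.mul_mem_mul (hf _) (hg _)
  algebraMap_mem' r n := by
    rw [PowerSeries.algebraMap_apply, PowerSeries.coeff_C]
    split_ifs with h
    · subst h
      rw [Sym.power, pow_zero]
      exact Submodule.algebraMap_mem r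
    · exact zero_mem _

/-- The component of a formal power series in `Sⁿ(V)`. -/
def Formal.coeff (n : ℕ) : Formal p V →ₗ[ℝ] Sym p V :=
  ((PowerSeries.coeff n : PowerSeries (Sym p V) →ₗ[Sym p V] Sym p V).restrictScalars ℝ) ∘ₗ
    (Formal p V).val.toLinearMap

/-- The canonical body map of the algebra of formal power series: the component in `S⁰(V) = ℝ`. -/
def Formal.body : Formal p V →+* ℝ :=
  ((Sym.aug p V : Sym p V →+* ℝ).comp PowerSeries.constantCoeff).comp
    ((Formal p V).val : Formal p V →+* PowerSeries (Sym p V))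

/-- The homogeneous formal power series of degree `k`. -/
def Formal.homog (k : I) : Submodule ℝ (Formal p V) :=
  ⨅ n, (Sym.homog p V k).comap (Formal.coeff p V n)

variable {p V}

theorem Formal.ext {f g : Formal p V}
    (h : ∀ n, Formal.coeff p V n f = Formal.coeff p V n g) : f = g :=
  Subtype.ext (PowerSeries.ext h)

theorem Formal.coeff_mem (f : Formal p V) (n : ℕ) : Formal.coeff p V n f ∈ Sym.power p V n :=
  f.2 n

theorem Formal.coeff_mul (f g : Formal p V) (n : ℕ) : Formal.coeff p V n (f * g) =
    ∑ q ∈ Finset.HasAntidiagonal.antidiagonal n, Formal.coeff p V q.1 f * Formal.coeff p V q.2 g :=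
  PowerSeries.coeff_mul n _ _

theorem Formal.mem_homog {k : I} {f : Formal p V} :
    f ∈ Formal.homog p V k ↔ ∀ n, Formal.coeff p V n f ∈ Sym.homog p V k := by
  simp [Formal.homog]

theorem Formal.body_eq (f : Formal p V) :
    Formal.body p V f = Sym.aug p V (Formal.coeff p V 0 f) := by
  simp [Formal.body, Formal.coeff]

theorem Sym.one_mem_homog : (1 : Sym p V) ∈ Sym.homog p V 0 :=
  Submodule.subset_span ⟨[], by simp, by simp, by simp⟩

theorem Sym.gen_mem_homog {i : I} {x : V.carrier} (hx : x ∈ V.grade i) :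
    Sym.gen p V x ∈ Sym.homog p V i :=
  Submodule.subset_span ⟨[(i, x)], by simpa using hx, by simp, by simp⟩

theorem Sym.homog_mul_le (i j : I) :
    Sym.homog p V i * Sym.homog p V j ≤ Sym.homog p V (i + j) := by
  rw [Sym.homog, Sym.homog, Submodule.span_mul_span, Submodule.span_le]
  rintro _ ⟨_, ⟨l, hl, rfl, rfl⟩, _, ⟨l', hl', rfl, rfl⟩, rfl⟩
  refine Submodule.subset_span ⟨l ++ l', ?_, by simp, by simp⟩
  intro q hq
  rcases List.mem_append.mp hq with h | h
  exacts [hl q h, hl' q h]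

/-! The homogeneous components of an element of `S(V)` are read off from the algebra homomorphism
`S(V) → S(V)[I]` that sends a homogeneous `v` of degree `i` to `v Xⁱ`. -/

theorem exists_grade_lift (V : GradedVectorSpace.{u, v} I) {B : Type w} [AddCommGroup B]
    [Module ℝ B] (f : I → V.carrier →ₗ[ℝ] B) :
    ∃ F : V.carrier →ₗ[ℝ] B, ∀ i, ∀ x ∈ V.grade i, F x = f i x := by
  classical
  have hint : DirectSum.IsInternal V.grade :=
    DirectSum.isInternal_submodule_of_iSupIndep_of_iSup_eq_top V.independent V.spans
  let e := LinearEquiv.ofBijective (DirectSum.coeLinearMap V.grade) hint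
  refine ⟨(DirectSum.toModule ℝ I B fun i => (f i) ∘ₗ (V.grade i).subtype) ∘ₗ
    e.symm.toLinearMap, fun i x hx => ?_⟩
  have : e.symm x = DirectSum.lof ℝ I (fun i => V.grade i) i ⟨x, hx⟩ := by
    rw [LinearEquiv.symm_apply_eq]
    exact (DirectSum.coeLinearMap_lof V.grade i ⟨x, hx⟩).symm
  simp [this]

theorem grade_induction (V : GradedVectorSpace.{u, v} I) {P : V.carrier → Prop}
    (h : ∀ i, ∀ x ∈ V.grade i, P x) (h0 : P 0) (hadd : ∀ x y, P x → P y → P (x + y))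
    (x : V.carrier) : P x :=
  Submodule.iSup_induction V.grade (motive := P) (V.spans ▸ Submodule.mem_top) h h0 hadd

theorem Sym.induction {P : Sym p V → Prop} (hr : ∀ r : ℝ, P (algebraMap ℝ _ r))
    (hg : ∀ i, ∀ x ∈ V.grade i, P (Sym.gen p V x)) (hm : ∀ a b, P a → P b → P (a * b))
    (ha : ∀ a b, P a → P b → P (a + b)) (s : Sym p V) : P s := by
  obtain ⟨t, rfl⟩ : ∃ t, Sym.mk p V t = s := RingQuot.mkAlgHom_surjective ℝ (SymRel p V) s
  induction t using TensorAlgebra.induction with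
  | algebraMap r => simpa using hr r
  | ι x =>
    refine grade_induction V (P := fun x => P (Sym.mk p V (TensorAlgebra.ι ℝ x))) hg ?_ ?_ x
    · simpa using hr 0
    · intro x y hx hy
      simpa using ha _ _ hx hy
  | mul a b ha' hb' => simpa using hm _ _ ha' hb'
  | add a b ha' hb' => simpa using ha _ _ ha' hb'

theorem koszulSign_comm (p : I →+ ZMod 2) (i j : I) : koszulSign p i j = koszulSign p j i := by
  rw [koszulSign, koszulSign, mul_comm]

theorem Sym.gen_mul_gen {i j : I} {x y : V.carrier} (hx : x ∈ V.grade i) (hy : y ∈ V.grade j) :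
    Sym.gen p V x * Sym.gen p V y = koszulSign p i j • (Sym.gen p V y * Sym.gen p V x) := by
  have h : Sym.mk p V _ = Sym.mk p V _ := RingQuot.mkAlgHom_rel ℝ (SymRel.comm (p := p) hx hy)
  simpa [Sym.gen] using h

theorem Sym.exists_coaction (p : I →+ ZMod 2) (V : GradedVectorSpace.{u, v} I) :
    ∃ Δ : Sym p V →ₐ[ℝ] AddMonoidAlgebra (Sym p V) I,
      ∀ i, ∀ x ∈ V.grade i, Δ (Sym.gen p V x) = AddMonoidAlgebra.single i (Sym.gen p V x) := by
  obtain ⟨F, hF⟩ := exists_grade_lift V (B := AddMonoidAlgebra (Sym p V) I) fun i =>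
    { toFun := fun x => AddMonoidAlgebra.single i (Sym.gen p V x)
      map_add' := fun x y => by simp
      map_smul' := fun r x => by simp }
  refine ⟨Sym.lift (TensorAlgebra.lift ℝ F) ?_, fun i x hx => ?_⟩
  · rintro _ _ ⟨hx, hy⟩
    rename_i i j x y
    have h1 := hF _ _ hx
    have h2 := hF _ _ hy
    simp only [LinearMap.coe_mk, AddHom.coe_mk] at h1 h2
    simp only [map_mul, map_smul, TensorAlgebra.lift_ι_apply, h1, h2,
      AddMonoidAlgebra.single_mul_single]
    rw [Sym.gen_mul_gen hx hy, add_comm i j, AddMonoidAlgebra.smul_single]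
  · have h1 := hF _ _ hx
    simp only [LinearMap.coe_mk, AddHom.coe_mk] at h1
    simp [Sym.gen, Sym.lift_mk, h1]

theorem coeff_mul_mem {A : Type w} [Ring A] [Algebra ℝ A] {P Q R : I → Submodule ℝ A}
    (h : ∀ i j, P i * Q j ≤ R (i + j)) {a b : AddMonoidAlgebra A I}
    (ha : ∀ k, a.coeff k ∈ P k) (hb : ∀ k, b.coeff k ∈ Q k) (k : I) : (a * b).coeff k ∈ R k := by
  classical
  rw [AddMonoidAlgebra.coeff_mul]
  refine Submodule.sum_mem _ fun i _ => Submodule.sum_mem _ fun j _ => ?_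
  dsimp only
  split_ifs with hk
  · exact hk ▸ h i j (Submodule.mul_mem_mul (ha i) (hb j))
  · exact zero_mem _

theorem Sym.iSup_homog : iSup (Sym.homog p V) = ⊤ := by
  refine Submodule.eq_top_iff'.mpr fun s => ?_
  induction s using Sym.induction with
  | hr r =>
    refine Submodule.mem_iSup_of_mem 0 ?_
    rw [Algebra.algebraMap_eq_smul_one]
    exact Submodule.smul_mem _ _ Sym.one_mem_homog
  | hg i x hx => exact Submodule.mem_iSup_of_mem i (Sym.gen_mem_homog hx)
  | hm a b ha hb =>
    have hle : iSup (Sym.homog p V) * iSup (Sym.homog p V) ≤ iSup (Sym.homog p V) := by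
      rw [Submodule.iSup_mul]
      refine iSup_le fun i => ?_
      rw [Submodule.mul_iSup]
      exact iSup_le fun j => (Sym.homog_mul_le i j).trans (le_iSup _ _)
    exact hle (Submodule.mul_mem_mul ha hb)
  | ha a b ha hb => exact add_mem ha hb

theorem Sym.exists_proj (p : I →+ ZMod 2) (V : GradedVectorSpace.{u, v} I) :
    ∃ π : I → Sym p V →ₗ[ℝ] Sym p V,
      (∀ k s, π k s ∈ Sym.homog p V k) ∧ (∀ k, ∀ s ∈ Sym.homog p V k, π k s = s) ∧
      (∀ i j, i ≠ j → ∀ s ∈ Sym.homog p V j, π i s = 0) ∧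
      (∀ s, (∀ k, π k s = 0) → s = 0) ∧
      ∀ n, ∀ s ∈ Sym.power p V n, ∀ k, π k s ∈ Sym.power p V n := by
  classical
  obtain ⟨Δ, hΔ⟩ := Sym.exists_coaction p V
  have key : ∀ k, ∀ s ∈ Sym.homog p V k, Δ s = AddMonoidAlgebra.single k s := by
    intro k s hs
    induction hs using Submodule.span_induction with
    | mem s hs =>
      obtain ⟨l, hl, rfl, rfl⟩ := hs
      induction l with
      | nil => simp [AddMonoidAlgebra.one_def]
      | cons q l ih =>
        have h1 := ih fun q' hq' => hl q' (by simp [hq'])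
        have h2 := hΔ q.1 q.2 (hl q (by simp))
        simp only [List.map_cons, List.prod_cons, List.sum_cons, map_mul, h1, h2,
          AddMonoidAlgebra.single_mul_single]
    | zero => simp
    | add s t _ _ hs ht => simp [hs, ht]
    | smul r s _ hs => simp [hs]
  have hsingle : ∀ (P : I → Submodule ℝ (Sym p V)) (i : I) (s : Sym p V), s ∈ P i →
      ∀ k, (AddMonoidAlgebra.single i s).coeff k ∈ P k := by
    intro P i s hs k
    rw [AddMonoidAlgebra.coeff_single, Finsupp.single_apply]
    split_ifs with h
    · exact h ▸ hs
    · exact zero_mem _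
  refine ⟨fun k =>
    { toFun := fun s => (Δ s).coeff k
      map_add' := fun s t => by simp
      map_smul' := fun r s => by simp }, ?_, ?_, ?_, ?_, ?_⟩
  · intro k s
    change (Δ s).coeff k ∈ _
    induction s using Sym.induction generalizing k with
    | hr r =>
      rw [key 0 _ (by rw [Algebra.algebraMap_eq_smul_one]; exact
        Submodule.smul_mem _ _ Sym.one_mem_homog)]
      refine hsingle (Sym.homog p V) _ _ ?_ k
      rw [Algebra.algebraMap_eq_smul_one]
      exact Submodule.smul_mem _ _ Sym.one_mem_homog
    | hg i x hx =>
      rw [hΔ i x hx]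
      exact hsingle (Sym.homog p V) _ _ (Sym.gen_mem_homog hx) k
    | hm a b ha hb =>
      rw [map_mul]
      exact coeff_mul_mem Sym.homog_mul_le ha hb k
    | ha a b ha hb =>
      rw [map_add]
      exact add_mem (ha k) (hb k)
  · intro k s hs
    simp [key k s hs]
  · intro i j hij s hs
    simp [key j s hs, hij.symm]
  · intro s hs
    have hsum : ((Δ s).coeff.sum fun _ a => a) = s := by
      have hs' : s ∈ iSup (Sym.homog p V) := Sym.iSup_homog (p := p) (V := V) ▸ Submodule.mem_top
      clear hs
      induction hs' using Submodule.iSup_induction' with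
      | mem k s hs => simp [key k s hs]
      | zero => simp
      | add s t _ _ hs ht =>
        rw [map_add, AddMonoidAlgebra.coeff_add, Finsupp.sum_add_index' (by simp) (by simp), hs, ht]
    rw [← hsum]
    have : (Δ s).coeff = 0 := Finsupp.ext hs
    simp [this]
  · intro n s hs
    change ∀ k, (Δ s).coeff k ∈ _
    induction hs using Submodule.pow_induction_on_left' with
    | algebraMap r =>
      rw [key 0 _ (by rw [Algebra.algebraMap_eq_smul_one]; exact
        Submodule.smul_mem _ _ Sym.one_mem_homog)]
      exact hsingle (fun _ => Sym.power p V 0) _ _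
        (by rw [Sym.power, pow_zero]; exact Submodule.algebraMap_mem r)
    | add x y n hx hy h1 h2 =>
      intro k
      rw [map_add]
      exact add_mem (h1 k) (h2 k)
    | mem_mul m hm n x hx h =>
      rw [map_mul]
      refine coeff_mul_mem (P := fun _ => LinearMap.range (Sym.gen p V))
        (Q := fun _ => Sym.power p V n) (R := fun _ => Sym.power p V (n + 1))
        (fun _ _ => (pow_succ' _ n).ge) ?_ h
      obtain ⟨x, rfl⟩ := hm
      refine grade_induction V (P := fun x => ∀ k, (Δ (Sym.gen p V x)).coeff k ∈
        LinearMap.range (Sym.gen p V)) ?_ (by simp) ?_ x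
      · intro i x hx k
        rw [hΔ i x hx]
        exact hsingle (fun _ => LinearMap.range (Sym.gen p V)) _ _ ⟨x, rfl⟩ k
      · intro x y hx hy k
        rw [map_add, map_add]
        exact add_mem (hx k) (hy k)

end Algebra
/-! ### Graded ringed spaces -/

/-- An `I`-graded ringed space with underlying topological space `X`: a sheaf of real `I`-graded
algebras on `X` whose restriction maps preserve the degree. -/
structure GradedRingedSpace (I : Type u) [AddMonoid I] (X : Type u₁) [TopologicalSpace X] where
  presheaf : TopCat.Presheaf (AlgCat.{w} ℝ) (TopCat.of X)
  isSheaf : TopCat.Presheaf.IsSheaf (presheaf ⋙ forget (AlgCat.{w} ℝ))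
  grade : ∀ U : Opens X, I → Submodule ℝ (presheaf.obj (op U))
  isGrading : ∀ U : Opens X, IsGrading (grade U)
  map_mem : ∀ {U V : Opens X} (h : U ≤ V) {i : I} {f : presheaf.obj (op V)}, f ∈ grade V i →
    (presheaf.map (homOfLE h).op).hom f ∈ grade U i

namespace GradedRingedSpace

variable {I : Type u} [AddMonoid I] {X : Type u₁} [TopologicalSpace X]

/-- The algebra of sections over `U`. -/
abbrev sec (O : GradedRingedSpace.{u, w} I X) (U : Opens X) : Type w := O.presheaf.obj (op U)

/-- The restriction of sections. -/
def res (O : GradedRingedSpace.{u, w} I X) {U V : Opens X} (h : U ≤ V) : O.sec V →ₐ[ℝ] O.sec U :=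
  (O.presheaf.map (homOfLE h).op).hom

/-- The open set `W` of the open subspace `U`, as an open set of `X`. -/
def openImage (U : Opens X) (W : Opens U) : Opens X :=
  (U.isOpenEmbedding (X := TopCat.of X)).functor.obj W

theorem mem_openImage {U : Opens X} {W : Opens U} {x : X} :
    x ∈ openImage U W ↔ ∃ h : x ∈ U, (⟨x, h⟩ : U) ∈ W := by
  constructor
  · rintro ⟨y, hy, rfl⟩
    exact ⟨y.2, hy⟩
  · rintro ⟨h, hx⟩
    exact ⟨⟨x, h⟩, hx, rfl⟩

/-- The restriction of a graded ringed space to an open subspace. -/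
def restrict (O : GradedRingedSpace.{u, w} I X) (U : Opens X) : GradedRingedSpace.{u, w} I U where
  presheaf := (U.isOpenEmbedding (X := TopCat.of X)).functor.op ⋙ O.presheaf
  isSheaf := TopCat.Presheaf.isSheaf_of_isOpenEmbedding
    (U.isOpenEmbedding (X := TopCat.of X)) O.isSheaf
  grade W := O.grade (openImage U W)
  isGrading W := O.isGrading (openImage U W)
  map_mem h := O.map_mem ((U.isOpenEmbedding (X := TopCat.of X)).functor.map (homOfLE h)).le

/-- A morphism `φ = (φ̃, φ^*)` of `I`-graded ringed spaces. -/
@[ext]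
structure Hom {Y : Type u₂} [TopologicalSpace Y] (O₁ : GradedRingedSpace.{u, w₁} I X)
    (O₂ : GradedRingedSpace.{u, w₂} I Y) where
  base : C(X, Y)
  app : ∀ U : Opens Y, O₂.sec U →+* O₁.sec (Opens.comap base U)
  naturality : ∀ {U V : Opens Y} (h : U ≤ V) (f : O₂.sec V),
    app U (O₂.res h f) = O₁.res (Opens.comap_mono base h) (app V f)
  app_mem : ∀ (U : Opens Y) {i : I} {f : O₂.sec U}, f ∈ O₂.grade U i →
    app U f ∈ O₁.grade (Opens.comap base U) i

namespace Hom

variable {Y : Type u₂} [TopologicalSpace Y] {Z : Type v} [TopologicalSpace Z]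
  {O₁ : GradedRingedSpace.{u, w₁} I X} {O₂ : GradedRingedSpace.{u, w₂} I Y}
  {O₃ : GradedRingedSpace.{u, w} I Z}

/-- The composite `ψ ∘ φ`. -/
def comp (ψ : Hom O₂ O₃) (φ : Hom O₁ O₂) : Hom O₁ O₃ where
  base := ψ.base.comp φ.base
  app U := (φ.app (Opens.comap ψ.base U)).comp (ψ.app U)
  naturality h f := (congrArg (φ.app _) (ψ.naturality h f)).trans
    (φ.naturality (Opens.comap_mono ψ.base h) (ψ.app _ f))
  app_mem U _ _ hf := φ.app_mem _ (ψ.app_mem U hf)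

/-- A morphism of graded ringed spaces is an isomorphism if it is a homeomorphism together with an
isomorphism of sheaves of graded rings. -/
structure IsIso (φ : Hom O₁ O₂) : Prop where
  isHomeomorph : IsHomeomorph φ.base
  bijective : ∀ U : Opens Y, Function.Bijective (φ.app U)
  mem_of_app_mem : ∀ (U : Opens Y) {i : I} {f : O₂.sec U},
    φ.app U f ∈ O₁.grade (Opens.comap φ.base U) i → f ∈ O₂.grade U i

/-- The pullback of global sections. -/
def globalPullback (φ : Hom O₁ O₂) : O₂.sec ⊤ →+* O₁.sec ⊤ := φ.app ⊤

end Hom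

end GradedRingedSpace

/-! ### Sheaves of smooth functions -/

section FunctionSheaf

variable {X : Type u₁} [TopologicalSpace X] {A : Type v} [Ring A] [Algebra ℝ A]

/-- The presheaf of algebras of `A`-valued functions subject to conditions that are stable under
restriction. -/
def functionPresheaf (S : ∀ U : Opens X, Subalgebra ℝ (U → A))
    (hS : ∀ {U V : Opens X} (h : U ≤ V) (f : V → A), f ∈ S V → f ∘ Opens.inclusion h ∈ S U) :
    TopCat.Presheaf (AlgCat.{max u₁ v} ℝ) (TopCat.of X) where
  obj U := AlgCat.of ℝ (S U.unop)
  map i := AlgCat.ofHom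
    { toFun := fun f => ⟨f.1 ∘ Opens.inclusion i.unop.le, hS i.unop.le f.1 f.2⟩
      map_one' := rfl
      map_mul' := fun _ _ => rfl
      map_zero' := rfl
      map_add' := fun _ _ => rfl
      commutes' := fun _ => rfl }
  map_id _ := rfl
  map_comp _ _ := rfl

theorem functionPresheaf_isSheaf (S : ∀ U : Opens X, Subalgebra ℝ (U → A))
    (hS : ∀ {U V : Opens X} (h : U ≤ V) (f : V → A), f ∈ S V → f ∘ Opens.inclusion h ∈ S U)
    (hloc : ∀ {U : Opens X} (f : U → A), (∀ x : U, ∃ (V : Opens X) (_ : x.1 ∈ V) (h : V ≤ U),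
      f ∘ Opens.inclusion h ∈ S V) → f ∈ S U) :
    TopCat.Presheaf.IsSheaf (functionPresheaf S hS ⋙ forget (AlgCat.{max u₁ v} ℝ)) := by
  let P : TopCat.LocalPredicate (X := TopCat.of X) fun _ => A :=
    { pred := fun {U} f => f ∈ S U
      res := fun i f hf => hS i.le f hf
      locality := fun f hf => hloc f fun x => by
        obtain ⟨V, hx, i, h⟩ := hf x
        exact ⟨V, hx, i.le, h⟩ }
  exact TopCat.subpresheafToTypes.isSheaf P

end FunctionSheaf

section Smooth

variable {I : Type u} [NonUnitalCommSemiring I] (n : ℕ) (M : Type u₁) [TopologicalSpace M]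
  [ChartedSpace (EuclideanSpace ℝ (Fin n)) M]

variable {n M} in
theorem contMDiff_of_locally {U : Opens M} (f : U → ℝ)
    (h : ∀ x : U, ∃ (V : Opens M) (_ : x.1 ∈ V) (h : V ≤ U),
      ContMDiff (𝓡 n) 𝓘(ℝ, ℝ) ∞ (f ∘ Opens.inclusion h)) : ContMDiff (𝓡 n) 𝓘(ℝ, ℝ) ∞ f := by
  intro x
  obtain ⟨V, hx, hVU, hV⟩ := h x
  exact ((contDiffWithinAt_localInvariantProp ∞).liftPropAt_iff_comp_inclusion hVU f
    ⟨x.1, hx⟩).mpr (hV ⟨x.1, hx⟩)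

/-- The algebra of smooth real functions on `U`. -/
def smoothFunctions (U : Opens M) : Subalgebra ℝ (U → ℝ) where
  carrier := {f | ContMDiff (𝓡 n) 𝓘(ℝ, ℝ) ∞ f}
  mul_mem' hf hg := hf.mul hg
  add_mem' hf hg := hf.add hg
  algebraMap_mem' _ := contMDiff_const

open Classical in
variable (I) in
/-- A manifold `M` with its sheaf of smooth real functions, all of degree `0`. -/
def smoothSpace : GradedRingedSpace.{u, u₁} I M where
  presheaf := functionPresheaf (smoothFunctions n M)
    fun h _ hf => ContMDiff.comp (I' := 𝓡 n) hf (contMDiff_inclusion h)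
  isSheaf := functionPresheaf_isSheaf _ _ fun f hf => contMDiff_of_locally f hf
  grade U i := (if i = 0 then ⊤ else ⊥ : Submodule ℝ (smoothFunctions n M U))
  isGrading U := by
    refine IsGrading.mk (A := smoothFunctions n M U) (by simp) ?_ ?_
    · intro i j a b ha hb
      by_cases hi : i = 0
      · by_cases hj : j = 0
        · simp [hi, hj]
        · have : b = 0 := by simpa [hj] using hb
          simp [this]
      · have : a = 0 := by simpa [hi] using ha
        simp [this]
    · refine ⟨fun i => if i = 0 then LinearMap.id else 0, ?_, ?_, ?_, ?_⟩
      · intro i a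
        by_cases h : i = 0 <;> simp [h]
      · intro i a ha
        by_cases h : i = 0
        · simp [h]
        · simpa [h, eq_comm] using ha
      · intro i j hij a ha
        by_cases h : i = 0
        · have hj : j ≠ 0 := fun h' => hij (h.trans h'.symm)
          simpa [h, hj] using ha
        · simp [h]
      · intro a ha
        simpa using ha 0
  map_mem {U V} h {i f} hf := by
    change f ∈ (if i = 0 then ⊤ else ⊥ : Submodule ℝ (smoothFunctions n M V)) at hf
    by_cases hi : i = 0
    · rw [if_pos hi]
      trivial
    · rw [if_neg hi] at hf ⊢
      have hf' : f = 0 := hf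
      rw [hf', map_zero]
      exact zero_mem (⊥ : Submodule ℝ (smoothFunctions n M U))

variable (p : I →+ ZMod 2) (V : GradedVectorSpace.{u, v} I)

variable {M p V} in
/-- A function with values in the algebra of formal power series on `V` is smooth if its
components in the finite-dimensional spaces `Sᵏ(V)` are smooth, that is, become smooth real
functions under all linear functionals. -/
def IsSmooth {U : Opens M} (f : U → Formal p V) : Prop :=
  ∀ (k : ℕ) (l : Module.Dual ℝ (Sym p V)),
    ContMDiff (𝓡 n) 𝓘(ℝ, ℝ) ∞ fun x => l (Formal.coeff p V k (f x))

variable {p V} in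
theorem Sym.power_fg (k : ℕ) : (Sym.power p V k).FG := by
  refine Submodule.FG.pow ?_ k
  rw [LinearMap.range_eq_map]
  exact Module.Finite.fg_top.map _

theorem exists_coordinates {A : Type v} [AddCommGroup A] [Module ℝ A] {P : Submodule ℝ A}
    (hP : P.FG) : ∃ (r : ℕ) (e : Fin r → A) (l : Fin r → Module.Dual ℝ A),
      ∀ s ∈ P, s = ∑ j, l j s • e j := by
  have : Module.Finite ℝ P := Module.Finite.iff_fg.mpr hP
  let b := Module.finBasis ℝ P
  choose l hl using fun j => LinearMap.exists_extend (b.coord j)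
  refine ⟨_, fun j => b j, l, fun s hs => ?_⟩
  have h1 : ∀ j, l j s = b.repr ⟨s, hs⟩ j := fun j =>
    LinearMap.congr_fun (hl j) (⟨s, hs⟩ : P)
  have h2 := congrArg P.subtype (b.sum_repr ⟨s, hs⟩)
  rw [map_sum] at h2
  simp only [h1]
  exact h2.symm

variable {n M p V} in
theorem IsSmooth.mul {U : Opens M} {f g : U → Formal p V} (hf : IsSmooth n f) (hg : IsSmooth n g) :
    IsSmooth n (f * g) := by
  intro k l
  have h : ∀ x, l (Formal.coeff p V k ((f * g) x)) =
      ∑ q ∈ Finset.HasAntidiagonal.antidiagonal k,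
        l (Formal.coeff p V q.1 (f x) * Formal.coeff p V q.2 (g x)) := by
    intro x
    rw [Pi.mul_apply, Formal.coeff_mul, map_sum]
  simp only [h]
  refine contMDiff_finsetSum fun q _ => ?_
  obtain ⟨r, e, a, he⟩ := exists_coordinates (Sym.power_fg (p := p) (V := V) q.1)
  obtain ⟨r', e', a', he'⟩ := exists_coordinates (Sym.power_fg (p := p) (V := V) q.2)
  have h' : ∀ x, l (Formal.coeff p V q.1 (f x) * Formal.coeff p V q.2 (g x)) =
      ∑ i, ∑ j, a i (Formal.coeff p V q.1 (f x)) * a' j (Formal.coeff p V q.2 (g x)) *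
        l (e i * e' j) := by
    intro x
    conv_lhs => rw [he _ (Formal.coeff_mem (f x) q.1), he' _ (Formal.coeff_mem (g x) q.2)]
    simp [Finset.sum_mul_sum, mul_assoc, mul_left_comm]
  simp only [h']
  exact contMDiff_finsetSum fun i _ => contMDiff_finsetSum fun j _ =>
    ((hf _ _).mul (hg _ _)).mul contMDiff_const

/-- The algebra of smooth functions on `U` with values in the formal power series on `V`. -/
def smoothFormalFunctions (U : Opens M) : Subalgebra ℝ (U → Formal p V) where
  carrier := {f | IsSmooth n f}
  mul_mem' hf hg := hf.mul hg
  add_mem' hf hg k l := by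
    simp only [Pi.add_apply, map_add]
    exact (hf k l).add (hg k l)
  algebraMap_mem' r k l := by
    change ContMDiff (𝓡 n) 𝓘(ℝ, ℝ) ∞ fun _ => l (Formal.coeff p V k (algebraMap ℝ _ r))
    exact contMDiff_const

/-- The smooth functions with values in the homogeneous formal power series of degree `i`. -/
def smoothFormalGrade (U : Opens M) (i : I) : Submodule ℝ (smoothFormalFunctions n M p V U) where
  carrier := {f | ∀ x, f.1 x ∈ Formal.homog p V i}
  add_mem' hf hg x := add_mem (hf x) (hg x)
  zero_mem' _ := zero_mem _
  smul_mem' r _ hf x := Submodule.smul_mem _ r (hf x)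

theorem Formal.exists_proj : ∃ π : I → Formal p V →ₗ[ℝ] Formal p V,
    (∀ i f, π i f ∈ Formal.homog p V i) ∧ (∀ i, ∀ f ∈ Formal.homog p V i, π i f = f) ∧
      (∀ i j, i ≠ j → ∀ f ∈ Formal.homog p V j, π i f = 0) ∧ (∀ f, (∀ i, π i f = 0) → f = 0) ∧
      ∀ i k, ∃ P : Sym p V →ₗ[ℝ] Sym p V, ∀ f,
        Formal.coeff p V k (π i f) = P (Formal.coeff p V k f) := by
  obtain ⟨π, h1, h2, h3, h4, h5⟩ := Sym.exists_proj p V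
  let ρ : I → Formal p V →ₗ[ℝ] Formal p V := fun i =>
    { toFun := fun f => ⟨PowerSeries.mk fun k => π i (Formal.coeff p V k f), fun k => by
        rw [PowerSeries.coeff_mk]
        exact h5 k _ (Formal.coeff_mem f k) i⟩
      map_add' := fun f g => Subtype.ext (by ext; simp)
      map_smul' := fun r f => Subtype.ext (by ext; simp) }
  have hρ : ∀ i k f, Formal.coeff p V k (ρ i f) = π i (Formal.coeff p V k f) := fun i k f =>
    PowerSeries.coeff_mk k fun k => π i (Formal.coeff p V k f)
  refine ⟨ρ, ?_, ?_, ?_, ?_, fun i k => ⟨π i, hρ i k⟩⟩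
  · intro i f
    rw [Formal.mem_homog]
    intro k
    rw [hρ]
    exact h1 i _
  · intro i f hf
    refine Formal.ext fun k => ?_
    rw [hρ]
    exact h2 i _ (Formal.mem_homog.mp hf k)
  · intro i j hij f hf
    refine Formal.ext fun k => ?_
    rw [hρ, map_zero]
    exact h3 i j hij _ (Formal.mem_homog.mp hf k)
  · intro f hf
    refine Formal.ext fun k => ?_
    rw [map_zero]
    refine h4 _ fun i => ?_
    rw [← hρ, hf i, map_zero]

theorem smoothFormalGrade_isGrading (U : Opens M) : IsGrading (A := smoothFormalFunctions n M p V U) (smoothFormalGrade n M p V U) where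
  one_mem _ := Formal.mem_homog.mpr fun k => by
    have h : Formal.coeff p V k 1 = if k = 0 then 1 else 0 := PowerSeries.coeff_one k
    change Formal.coeff p V k 1 ∈ _
    rw [h]
    split_ifs
    · exact Sym.one_mem_homog
    · exact zero_mem _
  mul_mem {i j a b} ha hb x := Formal.mem_homog.mpr fun k => by
    change Formal.coeff p V k (a.1 x * b.1 x) ∈ _
    rw [Formal.coeff_mul]
    exact Submodule.sum_mem _ fun q _ => Sym.homog_mul_le i j (Submodule.mul_mem_mul
      (Formal.mem_homog.mp (ha x) _) (Formal.mem_homog.mp (hb x) _))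
  exists_proj := by
    obtain ⟨π, h1, h2, h3, h4, h5⟩ := Formal.exists_proj p V
    refine ⟨fun i =>
      { toFun := fun f => ⟨fun x => π i (f.1 x), fun k l => by
          obtain ⟨P, hP⟩ := h5 i k
          simp only [hP]
          exact f.2 k (l ∘ₗ P)⟩
        map_add' := fun f g => Subtype.ext (funext fun x => map_add (π i) _ _)
        map_smul' := fun r f => Subtype.ext (funext fun x => map_smul (π i) _ _) }, ?_, ?_, ?_, ?_⟩
    · exact fun i f x => h1 i _
    · exact fun i f hf => Subtype.ext (funext fun x => h2 i _ (hf x))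
    · exact fun i j hij f hf => Subtype.ext (funext fun x => h3 i j hij _ (hf x))
    · exact fun f hf => Subtype.ext (funext fun x => h4 _ fun i =>
        congrFun (congrArg Subtype.val (hf i)) x)

/-- A manifold `M` with the sheaf of smooth functions with values in the formal power series
on `V`. -/
def smoothFormalSpace : GradedRingedSpace.{u, max u₁ v} I M where
  presheaf := functionPresheaf (A := Formal p V) (smoothFormalFunctions n M p V)
    fun {U W} h f (hf : IsSmooth n f) k l =>
      ContMDiff.comp (I' := 𝓡 n) (g := fun x => l (Formal.coeff p V k (f x))) (hf k l)
        (contMDiff_inclusion h)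
  isSheaf := functionPresheaf_isSheaf (A := Formal p V) _ _ fun f hf k l =>
    contMDiff_of_locally _ fun x => by
    obtain ⟨V, hx, h, hV⟩ := hf x
    exact ⟨V, hx, h, hV k l⟩
  grade := smoothFormalGrade n M p V
  isGrading := smoothFormalGrade_isGrading n M p V
  map_mem _ _ _ hf _ := hf _

end Smooth

/-! ### Body maps, graded domains and graded manifolds -/

section Body

variable {I : Type u} [NonUnitalCommSemiring I]

/-- A morphism `O → C^∞` of sheaves of graded rings on the manifold `M`: the datum that makes `M`
an underlying manifold of `(M, O)`. -/
@[ext]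
structure BodyMap (n : ℕ) {M : Type u₁} [TopologicalSpace M]
    [ChartedSpace (EuclideanSpace ℝ (Fin n)) M] (O : GradedRingedSpace.{u, w} I M) where
  app : ∀ U : Opens M, O.sec U →+* (smoothSpace I n M).sec U
  naturality : ∀ {U V : Opens M} (h : U ≤ V) (f : O.sec V),
    app U (O.res h f) = (smoothSpace I n M).res h (app V f)
  app_mem : ∀ (U : Opens M) {i : I} {f : O.sec U}, f ∈ O.grade U i →
    app U f ∈ (smoothSpace I n M).grade U i

section

variable {n : ℕ} {M : Type u₁} [TopologicalSpace M] [ChartedSpace (EuclideanSpace ℝ (Fin n)) M]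

/-- The value at `x ∈ U` of the image of a section `f` over `U`. -/
def BodyMap.val {O : GradedRingedSpace.{u, w} I M} (ε : BodyMap n O) {U : Opens M} (f : O.sec U)
    (x : M) (hx : x ∈ U) : ℝ :=
  (show smoothFunctions n M U from ε.app U f).1 ⟨x, hx⟩

/-- A morphism `O → C^∞` as a morphism `M → (M, O)` of graded ringed spaces that is the identity
on `M`. -/
def BodyMap.embedding {O : GradedRingedSpace.{u, w} I M} (ε : BodyMap n O) :
    GradedRingedSpace.Hom (smoothSpace I n M) O where
  base := ContinuousMap.id M
  app := ε.app
  naturality := ε.naturality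
  app_mem := ε.app_mem

/-- A smooth map of manifolds as a morphism of graded ringed spaces. -/
def smoothHom {n' : ℕ} {N : Type u₂} [TopologicalSpace N]
    [ChartedSpace (EuclideanSpace ℝ (Fin n')) N] (φ : C(M, N))
    (hφ : ContMDiff (𝓡 n) (𝓡 n') ∞ φ) :
    GradedRingedSpace.Hom (smoothSpace I n M) (smoothSpace I n' N) where
  base := φ
  app U :=
    { toFun := fun f => (⟨fun x => (show smoothFunctions n' N U from f).1 ⟨φ x.1, x.2⟩, by
        refine ContMDiff.comp (I' := 𝓡 n') (show smoothFunctions n' N U from f).2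
          (f := fun x : Opens.comap φ U => (⟨φ x.1, x.2⟩ : U)) ?_
        rw [← ContMDiff.subtypeVal_comp_iff]
        exact hφ.comp contMDiff_subtype_val⟩ : smoothFunctions n M (Opens.comap φ U))
      map_one' := rfl
      map_mul' := fun _ _ => rfl
      map_zero' := rfl
      map_add' := fun _ _ => rfl }
  naturality _ _ := rfl
  app_mem U i f hf := by
    classical
    change f ∈ (if i = 0 then ⊤ else ⊥ : Submodule ℝ (smoothFunctions n' N U)) at hf
    change _ ∈ (if i = 0 then ⊤ else ⊥ : Submodule ℝ (smoothFunctions n M (Opens.comap φ U)))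
    by_cases hi : i = 0
    · rw [if_pos hi]
      trivial
    · rw [if_neg hi] at hf ⊢
      have hf' : f = 0 := hf
      rw [hf', map_zero]
      exact zero_mem (⊥ : Submodule ℝ (smoothFunctions n M (Opens.comap φ U)))

end

theorem Formal.body_eq_zero {p : I →+ ZMod 2} {V : GradedVectorSpace.{u, v} I} {i : I}
    (hi : i ≠ 0) {f : Formal p V} (hf : f ∈ Formal.homog p V i) : Formal.body p V f = 0 := by
  rw [Formal.body_eq]
  have h0 := Formal.mem_homog.mp hf 0
  generalize Formal.coeff p V 0 f = s at h0
  induction h0 using Submodule.span_induction with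
  | mem s hs =>
    obtain ⟨l, hl, rfl, rfl⟩ := hs
    cases l with
    | nil => simp at hi
    | cons q l => simp [Sym.aug, Sym.gen, Sym.lift_mk]
  | zero => simp
  | add s t _ _ hs ht => simp [hs, ht]
  | smul r s _ hs => simp [hs]

/-- The canonical body map of the sheaf of smooth functions with values in the formal power series
on `V`. -/
def canonicalBody (n : ℕ) (M : Type u₁) [TopologicalSpace M]
    [ChartedSpace (EuclideanSpace ℝ (Fin n)) M] (p : I →+ ZMod 2)
    (V : GradedVectorSpace.{u, v} I) : BodyMap n (smoothFormalSpace n M p V) where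
  app U :=
    { toFun := fun f => (⟨fun x =>
        Formal.body p V ((show smoothFormalFunctions n M p V U from f).1 x), by
          have h := (show smoothFormalFunctions n M p V U from f).2 0 (Sym.aug p V).toLinearMap
          change ContMDiff (𝓡 n) 𝓘(ℝ, ℝ) ∞ _
          simp only [Formal.body_eq]
          exact h⟩ : smoothFunctions n M U)
      map_one' := Subtype.ext (funext fun _ => map_one (Formal.body p V))
      map_mul' := fun _ _ => Subtype.ext (funext fun _ => map_mul (Formal.body p V) _ _)
      map_zero' := Subtype.ext (funext fun _ => map_zero (Formal.body p V))
      map_add' := fun _ _ => Subtype.ext (funext fun _ => map_add (Formal.body p V) _ _) }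
  naturality _ _ := rfl
  app_mem U i f hf := by
    classical
    change _ ∈ (if i = 0 then ⊤ else ⊥ : Submodule ℝ (smoothFunctions n M U))
    by_cases hi : i = 0
    · rw [if_pos hi]
      trivial
    · rw [if_neg hi]
      exact (Submodule.mem_bot ℝ).mpr (Subtype.ext (funext fun x => Formal.body_eq_zero hi (hf x)))

variable {n : ℕ} {M : Type u₁} [TopologicalSpace M] [ChartedSpace (EuclideanSpace ℝ (Fin n)) M]

/-- The `I`-graded domain with underlying open set `D ⊆ ℝⁿ` and fibre `V`. -/
abbrev gradedDomain (p : I →+ ZMod 2) (V : GradedVectorSpace.{u, v} I)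
    (D : Opens (EuclideanSpace ℝ (Fin n))) : GradedRingedSpace.{u, v} I D :=
  smoothFormalSpace n D p V

/-- A chart of the graded ringed space `(M, O)`: an isomorphism of an open part of it with a graded
domain, whose underlying map is compatible with the smooth structure of `M`. -/
structure GradedChart (p : I →+ ZMod 2) (V : GradedVectorSpace.{u, v} I)
    (O : GradedRingedSpace.{u, w} I M) where
  source : Opens M
  target : Opens (EuclideanSpace ℝ (Fin n))
  map : GradedRingedSpace.Hom (O.restrict source) (gradedDomain p V target)
  isIso : map.IsIso
  isDiffeo : ∃ e : Diffeomorph (𝓡 n) (𝓡 n) source target ∞, ⇑e = map.base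

/-- `(M, O)` is an `I`-graded manifold of dimension `n | (dim Vᵢ)`. -/
def IsGradedManifold (p : I →+ ZMod 2) (V : GradedVectorSpace.{u, v} I)
    (O : GradedRingedSpace.{u, w} I M) : Prop :=
  ∀ x : M, ∃ c : GradedChart (n := n) p V O, x ∈ c.source

/-- The morphism `ε : O → C^∞` is the body map of the graded manifold `(M, O)`: in every chart it
is the canonical body map of the graded domain. -/
def BodyMap.IsCanonical (p : I →+ ZMod 2) (V : GradedVectorSpace.{u, v} I)
    {O : GradedRingedSpace.{u, w} I M} (ε : BodyMap n O) : Prop :=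
  ∀ (c : GradedChart (n := n) p V O) (W : Opens c.target) (g : (gradedDomain p V c.target).sec W)
    (x : c.source) (hx : c.map.base x ∈ W),
    ε.val (U := GradedRingedSpace.openImage c.source (Opens.comap c.map.base W)) (c.map.app W g) x
        (GradedRingedSpace.mem_openImage.mpr ⟨x.2, hx⟩) =
      (canonicalBody n c.target p V).val g (c.map.base x) hx

end Body

end MonoidallyGraded

end

/-! Everything rests on one fact: the stalk of a graded manifold at a point has exactly one ring
homomorphism to ℝ. In a graded domain, a section whose body does not vanish at `x` is invertible
near `x`: dividing by the body leaves `1 - h` with `h` free of constant term, and the geometric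
series `∑ hᵏ` converges in `∏ Sⁿ(V)` (`isUnit_smoothFormalFunctions`). If a homomorphism `e'`
differed at `f` from evaluation `e` of the body, then `f - e'(f)` would have non-zero value under
`e`, hence be a unit of the stalk, yet `e'` kills it (`PointEval.IsLocal.ev_eq`). This uses neither
the grading nor ℝ-linearity of `e'`.

Charts carry this unique real point from domains to manifolds, which yields existence, uniqueness
and the canonical form of the body map. Composing the real point at `x` with `φ^*` gives a real
point at `φ̃(x)`, which can only be the body there; this is the formula of part 1
(`BodyMap.val_app`).

Smooth functions on `N` lift locally to sections (`BodyMap.Lifts`), so `φ̃` pulls smooth functions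
back to smooth functions, and applying this to coordinates cut off by a bump function shows that
`φ̃` is smooth. For part 2, a lifted bump function extended by zero is a global section whose body
separates two given points of `N`. -/

noncomputable section

namespace MonoidallyGraded

universe u v w u₁ u₂ w₁ w₂

open GradedRingedSpace

/-! ### Real points of stalks -/

section PointEval

variable {I : Type u} [AddMonoid I] {X : Type u₁} [TopologicalSpace X]

/-- A ring homomorphism from the stalk of `O` at `x` to `ℝ`. -/
structure PointEval (O : GradedRingedSpace.{u, w} I X) (x : X) where
  ev : ∀ U : Opens X, x ∈ U → O.sec U →+* ℝ
  ev_res : ∀ {U V : Opens X} (h : U ≤ V) (hx : x ∈ U) (f : O.sec V),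
    ev U hx (O.res h f) = ev V (h hx) f

/-- Sections with a non-zero value at `x` are invertible near `x`. -/
def PointEval.IsLocal {O : GradedRingedSpace.{u, w} I X} {x : X} (e : PointEval O x) : Prop :=
  ∀ (U : Opens X) (hx : x ∈ U) (f : O.sec U), e.ev U hx f ≠ 0 →
    ∃ (W : Opens X) (h : W ≤ U), x ∈ W ∧ IsUnit (O.res h f)

/-- The identity is the only ring endomorphism of ℝ, so linearity of a real point need not be
assumed. -/
theorem PointEval.ev_algebraMap {O : GradedRingedSpace.{u, w} I X} {x : X} (e : PointEval O x)
    (U : Opens X) (hx : x ∈ U) (r : ℝ) : e.ev U hx (algebraMap ℝ (O.sec U) r) = r := by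
  have h : (e.ev U hx).comp (algebraMap ℝ (O.sec U)) = RingHom.id ℝ := Subsingleton.elim _ _
  exact RingHom.congr_fun h r

/-- Uniqueness of the real point: otherwise `f - e'(f)` is invertible near `x` because `e` does not
kill it, while `e'` sends it to zero. -/
theorem PointEval.IsLocal.ev_eq {O : GradedRingedSpace.{u, w} I X} {x : X} {e : PointEval O x}
    (he : e.IsLocal) (e' : PointEval O x) (U : Opens X) (hx : x ∈ U) (f : O.sec U) :
    e'.ev U hx f = e.ev U hx f := by
  by_contra hne
  obtain ⟨W, h, hxW, hu⟩ := he U hx (f - algebraMap ℝ _ (e'.ev U hx f)) (by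
    rw [map_sub, ev_algebraMap, sub_ne_zero]
    exact Ne.symm hne)
  have hu' := hu.map (e'.ev W hxW)
  rw [e'.ev_res, map_sub, ev_algebraMap, sub_self] at hu'
  exact not_isUnit_zero hu'

/-- The image of a point under a morphism. -/
def PointEval.map {Y : Type u₂} [TopologicalSpace Y] {O₁ : GradedRingedSpace.{u, w₁} I X}
    {O₂ : GradedRingedSpace.{u, w₂} I Y} (φ : Hom O₁ O₂) {x : X} (e : PointEval O₁ x) :
    PointEval O₂ (φ.base x) where
  ev U hx := (e.ev (Opens.comap φ.base U) hx).comp (φ.app U)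
  ev_res h hx f := (congrArg _ (φ.naturality h f)).trans
    (e.ev_res (Opens.comap_mono φ.base h) hx (φ.app _ f))

/-- A point of an open subset `U` as a point of the open subspace `U`. -/
def PointEval.restrict {O : GradedRingedSpace.{u, w} I X} {U : Opens X} {x : U}
    (e : PointEval O x.1) : PointEval (O.restrict U) x where
  ev W hx := e.ev (openImage U W) (mem_openImage.mpr ⟨x.2, hx⟩)
  ev_res h _ f := e.ev_res (((U.isOpenEmbedding (X := TopCat.of X)).functor.map
    (homOfLE h)).le) _ f

theorem GradedRingedSpace.res_res (O : GradedRingedSpace.{u, w} I X) {U V W : Opens X}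
    (h : U ≤ V) (h' : V ≤ W) (f : O.sec W) : O.res h (O.res h' f) = O.res (h.trans h') f := by
  have := congrArg (fun g => g.hom f) (O.presheaf.map_comp (homOfLE h').op (homOfLE h).op)
  exact this.symm

theorem openImage_comap_le (U V : Opens X) :
    openImage U (Opens.comap ⟨Subtype.val, continuous_subtype_val⟩ V) ≤ V := fun _ hx =>
  (mem_openImage.mp hx).2

theorem openImage_mono {U : Opens X} {W W' : Opens U} (h : W ≤ W') :
    openImage U W ≤ openImage U W' :=
  ((U.isOpenEmbedding (X := TopCat.of X)).functor.map (homOfLE h)).le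

theorem PointEval.exists_isLocal_of_restrict {O : GradedRingedSpace.{u, w} I X} {U : Opens X}
    {x : U} {e : PointEval (O.restrict U) x} (he : e.IsLocal) :
    ∃ e' : PointEval O x.1, e'.IsLocal := by
  refine ⟨{ ev := fun V hx => (e.ev (Opens.comap ⟨Subtype.val, continuous_subtype_val⟩ V) hx).comp
              (O.res (openImage_comap_le U V)).toRingHom
            ev_res := fun {V V'} h hx f => ?_ }, ?_⟩
  · have h1 := e.ev_res (Opens.comap_mono ⟨Subtype.val, continuous_subtype_val⟩ h) hx
      (O.res (openImage_comap_le U V') f)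
    refine Eq.trans ?_ h1
    refine congrArg (e.ev _ _) ?_
    exact (O.res_res _ _ f).trans
      (O.res_res (openImage_mono (Opens.comap_mono _ h)) (openImage_comap_le U V') f).symm
  · intro V hx f hf
    obtain ⟨W, h, hxW, hu⟩ := he _ hx _ hf
    refine ⟨openImage U W, (openImage_mono h).trans (openImage_comap_le U V),
      mem_openImage.mpr ⟨x.2, hxW⟩, ?_⟩
    rw [← O.res_res (openImage_mono h) (openImage_comap_le U V)]
    exact hu

/-- `φ.app` can only be inverted on sections over preimages. Every open `V` of `X` is the preimage
of its image `Opens.comap σ V`; passing there by the restriction along `hle` instead of by the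
equality of the two open sets avoids casts between section rings. -/
theorem PointEval.exists_isLocal_of_isIso {Y : Type u₂} [TopologicalSpace Y]
    {O₁ : GradedRingedSpace.{u, w₁} I X} {O₂ : GradedRingedSpace.{u, w₂} I Y} {φ : Hom O₁ O₂}
    (hφ : φ.IsIso) {x : X} {e : PointEval O₂ (φ.base x)} (he : e.IsLocal) :
    ∃ e' : PointEval O₁ x, e'.IsLocal := by
  let σ : C(Y, X) :=
    ⟨(hφ.isHomeomorph.homeomorph).symm, (hφ.isHomeomorph.homeomorph).symm.continuous⟩
  have hσ : ∀ x, σ (φ.base x) = x := (hφ.isHomeomorph.homeomorph).symm_apply_apply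
  have hle : ∀ V, Opens.comap φ.base (Opens.comap σ V) ≤ V := fun V y (hy : σ (φ.base y) ∈ V) => by
    rwa [hσ] at hy
  let τ : ∀ U, O₂.sec U ≃+* O₁.sec (Opens.comap φ.base U) := fun U =>
    RingEquiv.ofBijective (φ.app U) (hφ.bijective U)
  have hτ : ∀ U f, τ U f = φ.app U f := fun _ _ => rfl
  have hx' : ∀ V : Opens X, x ∈ V → φ.base x ∈ Opens.comap σ V := fun V hx => by
    change σ (φ.base x) ∈ V
    rwa [hσ]
  refine ⟨{ ev := fun V hx => ((e.ev (Opens.comap σ V) (hx' V hx)).comp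
              ((τ (Opens.comap σ V)).symm : _ →+* _)).comp (O₁.res (hle V)).toRingHom
            ev_res := fun {V V'} h hx f => ?_ }, ?_⟩
  · have h1 := e.ev_res (Opens.comap_mono σ h) (hx' V hx)
      ((τ (Opens.comap σ V')).symm (O₁.res (hle V') f))
    refine Eq.trans ?_ h1
    refine congrArg (e.ev _ _) ?_
    refine (RingEquiv.symm_apply_eq _).mpr ?_
    rw [hτ, φ.naturality, ← hτ, RingEquiv.apply_symm_apply]
    exact (O₁.res_res _ _ f).trans (O₁.res_res _ _ f).symm
  · intro V hx f hf
    obtain ⟨W, h, hxW, hu⟩ := he _ (hx' V hx) _ hf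
    refine ⟨Opens.comap φ.base W, (Opens.comap_mono φ.base h).trans (hle V), hxW, ?_⟩
    have := hu.map (φ.app W)
    rw [φ.naturality] at this
    change IsUnit (O₁.res _ (τ _ ((τ _).symm (O₁.res (hle V) f)))) at this
    rwa [RingEquiv.apply_symm_apply, O₁.res_res] at this

end PointEval

/-! ### Gluing two sections -/

theorem GradedRingedSpace.exists_glue {I : Type u} [AddMonoid I] {X : Type u₁}
    [TopologicalSpace X] (O : GradedRingedSpace.{u, w} I X) {U V : Opens X} (hUV : U ⊔ V = ⊤)
    (s : O.sec U) (t : O.sec V)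
    (h : O.res (inf_le_left : U ⊓ V ≤ U) s = O.res (inf_le_right : U ⊓ V ≤ V) t) :
    ∃ r : O.sec ⊤, O.res le_top r = s ∧ O.res le_top r = t := by
  -- The sheaf condition takes covers indexed in the universe of `X`, hence the lifted two-element
  -- index type.
  let c : ULift.{u₁} Bool → Opens (TopCat.of X) := fun
    | ⟨true⟩ => U
    | ⟨false⟩ => V
  have hc : iSup c = ⊤ := top_le_iff.mp (hUV.ge.trans (sup_le (le_iSup c ⟨true⟩)
    (le_iSup c ⟨false⟩)))
  obtain ⟨r, hr, -⟩ := (TopCat.Presheaf.isSheaf_iff_isSheafUniqueGluing_types _).mp O.isSheaf c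
    (fun
      | ⟨true⟩ => s
      | ⟨false⟩ => t) (by
    rintro ⟨_ | _⟩ ⟨_ | _⟩
    · rfl
    · have := congrArg (O.res (inf_comm V U).le) h.symm
      rw [O.res_res, O.res_res] at this
      exact this
    · exact h
    · rfl)
  refine ⟨O.res hc.ge r, ?_, ?_⟩
  · rw [O.res_res]
    exact hr ⟨true⟩
  · rw [O.res_res]
    exact hr ⟨false⟩

variable {I : Type u} [NonUnitalCommSemiring I]

/-! ### Inverses of formal power series -/

section Formal

variable {p : I →+ ZMod 2} {V : GradedVectorSpace.{u, v} I}

theorem Formal.coeff_one (k : ℕ) : Formal.coeff p V k 1 = if k = 0 then 1 else 0 :=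
  PowerSeries.coeff_one k

theorem Formal.coeff_algebraMap (k : ℕ) (r : ℝ) :
    Formal.coeff p V k (algebraMap ℝ _ r) = if k = 0 then algebraMap ℝ _ r else 0 := by
  rw [Algebra.algebraMap_eq_smul_one, map_smul, Formal.coeff_one]
  split_ifs
  · rw [Algebra.algebraMap_eq_smul_one]
  · rw [smul_zero]

/-- `S⁰(V)` is spanned by `1`, so the constant coefficient is a scalar; the augmentation loses
nothing there. -/
theorem Formal.coeff_zero_eq (f : Formal p V) :
    Formal.coeff p V 0 f = algebraMap ℝ _ (Formal.body p V f) := by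
  have h : Formal.coeff p V 0 f ∈ (1 : Submodule ℝ (Sym p V)) := by
    simpa [Sym.power] using Formal.coeff_mem f 0
  obtain ⟨r, hr⟩ := Submodule.mem_one.mp h
  rw [Formal.body_eq, ← hr, AlgHom.commutes]
  rfl

theorem Formal.coeff_pow_eq_zero {h : Formal p V} (h0 : Formal.coeff p V 0 h = 0) {k n : ℕ}
    (hn : n < k) : Formal.coeff p V n (h ^ k) = 0 := by
  induction k generalizing n with
  | zero => omega
  | succ k ih =>
    rw [pow_succ, Formal.coeff_mul]
    refine Finset.sum_eq_zero fun q hq => ?_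
    rw [Finset.HasAntidiagonal.mem_antidiagonal] at hq
    rcases Nat.eq_zero_or_pos q.2 with h2 | h2
    · rw [h2, h0, mul_zero]
    · rw [ih (by omega), zero_mul]

/-- The geometric series `∑ hᵏ` of a formal power series without constant term. -/
def Formal.geom (h : Formal p V) : Formal p V :=
  ⟨PowerSeries.mk fun n => Formal.coeff p V n (∑ k ∈ Finset.range (n + 1), h ^ k), fun n => by
    rw [PowerSeries.coeff_mk]
    exact Formal.coeff_mem _ n⟩

theorem Formal.coeff_geom (h : Formal p V) (n : ℕ) :
    Formal.coeff p V n (Formal.geom h) = Formal.coeff p V n (∑ k ∈ Finset.range (n + 1), h ^ k) :=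
  PowerSeries.coeff_mk n fun n => Formal.coeff p V n (∑ k ∈ Finset.range (n + 1), h ^ k)

/-- The power `hʲ` starts in degree `j`, so partial sums of any length beyond `k` share their
coefficient in degree `k`. Identities for finite geometric sums thus pass to the series one degree
at a time. -/
theorem Formal.coeff_geom_of_le {h : Formal p V} (h0 : Formal.coeff p V 0 h = 0) {k n : ℕ}
    (hk : k ≤ n) :
    Formal.coeff p V k (Formal.geom h) = Formal.coeff p V k (∑ j ∈ Finset.range (n + 1), h ^ j) := by
  rw [Formal.coeff_geom, map_sum, map_sum]
  refine Finset.sum_subset (Finset.range_mono (by omega)) fun j _ hj => ?_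
  exact Formal.coeff_pow_eq_zero h0 (by simpa [Nat.lt_succ_iff] using hj)

theorem Formal.one_sub_mul_geom {h : Formal p V} (h0 : Formal.coeff p V 0 h = 0) :
    (1 - h) * Formal.geom h = 1 := by
  refine Formal.ext fun n => ?_
  have key : Formal.coeff p V n ((1 - h) * Formal.geom h) =
      Formal.coeff p V n ((1 - h) * ∑ j ∈ Finset.range (n + 1), h ^ j) := by
    rw [Formal.coeff_mul, Formal.coeff_mul]
    refine Finset.sum_congr rfl fun q hq => ?_
    rw [Finset.HasAntidiagonal.mem_antidiagonal] at hq
    rw [Formal.coeff_geom_of_le h0 (show q.2 ≤ n by omega)]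
  rw [key, mul_neg_geom_sum, map_sub, Formal.coeff_pow_eq_zero h0 n.lt_succ_self, sub_zero]

/-- Needed besides `Formal.one_sub_mul_geom`, since the multiplication is commutative only up to
sign. -/
theorem Formal.geom_mul_one_sub {h : Formal p V} (h0 : Formal.coeff p V 0 h = 0) :
    Formal.geom h * (1 - h) = 1 := by
  refine Formal.ext fun n => ?_
  have key : Formal.coeff p V n (Formal.geom h * (1 - h)) =
      Formal.coeff p V n ((∑ j ∈ Finset.range (n + 1), h ^ j) * (1 - h)) := by
    rw [Formal.coeff_mul, Formal.coeff_mul]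
    refine Finset.sum_congr rfl fun q hq => ?_
    rw [Finset.HasAntidiagonal.mem_antidiagonal] at hq
    rw [Formal.coeff_geom_of_le h0 (show q.1 ≤ n by omega)]
  rw [key, geom_sum_mul_neg, map_sub, Formal.coeff_pow_eq_zero h0 n.lt_succ_self, sub_zero]

end Formal

/-! ### Invertible sections of graded domains and uniqueness of body maps. -/

section Body

variable {n : ℕ} {M : Type u₁} [TopologicalSpace M] [ChartedSpace (EuclideanSpace ℝ (Fin n)) M]

theorem isSmooth_algebraMap {p : I →+ ZMod 2} {V : GradedVectorSpace.{u, v} I} {U : Opens M}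
    {a : U → ℝ} (ha : ContMDiff (𝓡 n) 𝓘(ℝ, ℝ) ∞ a) :
    IsSmooth n fun x => algebraMap ℝ (Formal p V) (a x) := by
  intro k l
  simp only [Formal.coeff_algebraMap]
  split_ifs
  · simp only [Algebra.algebraMap_eq_smul_one, map_smul, smul_eq_mul]
    exact ha.mul contMDiff_const
  · simpa using contMDiff_const

/-- In degree `k` the series agrees with a polynomial in `f` that does not depend on the point, and
smooth functions form an algebra. -/
theorem isSmooth_geom {p : I →+ ZMod 2} {V : GradedVectorSpace.{u, v} I} {U : Opens M}
    {f : U → Formal p V} (hf : IsSmooth n f) : IsSmooth n fun x => Formal.geom (f x) := by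
  intro k l
  have h := (∑ j ∈ Finset.range (k + 1), (⟨f, hf⟩ : smoothFormalFunctions n M p V U) ^ j).2 k l
  simpa [Formal.coeff_geom] using h

theorem isSmooth_body {p : I →+ ZMod 2} {V : GradedVectorSpace.{u, v} I} {U : Opens M}
    {f : U → Formal p V} (hf : IsSmooth n f) :
    ContMDiff (𝓡 n) 𝓘(ℝ, ℝ) ∞ fun x => Formal.body p V (f x) := by
  simp only [Formal.body_eq]
  exact hf 0 (Sym.aug p V).toLinearMap

/-- With `b` the body of `f` and `a` its inverse, `f = b (1 - h)` for `h = 1 - a f`. The factor `b`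
is invertible as a smooth scalar function, and `1 - h` by the geometric series. -/
theorem isUnit_smoothFormalFunctions {p : I →+ ZMod 2} {V : GradedVectorSpace.{u, v} I}
    {U : Opens M} (f : smoothFormalFunctions n M p V U)
    (hf : ∀ x, Formal.body p V (f.1 x) ≠ 0) : IsUnit f := by
  have hinv : ContMDiff (𝓡 n) 𝓘(ℝ, ℝ) ∞ fun x => (Formal.body p V (f.1 x))⁻¹ :=
    (isSmooth_body f.2).inv₀ hf
  let a : smoothFormalFunctions n M p V U := ⟨_, isSmooth_algebraMap hinv⟩
  let b : smoothFormalFunctions n M p V U := ⟨_, isSmooth_algebraMap (isSmooth_body f.2)⟩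
  have hab : a * b = 1 := Subtype.ext (funext fun x => by
    change algebraMap ℝ (Formal p V) _ * algebraMap ℝ (Formal p V) _ = 1
    rw [← map_mul, inv_mul_cancel₀ (hf x), map_one])
  have hcomm : ∀ g, a * g = g * a := fun g => Subtype.ext (funext fun x =>
    Algebra.commutes ((Formal.body p V (f.1 x))⁻¹) (g.1 x))
  have hba : b * a = 1 := by rw [← hcomm, hab]
  let h : smoothFormalFunctions n M p V U := 1 - a * f
  have h0 : ∀ x, Formal.coeff p V 0 (h.1 x) = 0 := fun x => by
    change Formal.coeff p V 0 (1 - algebraMap ℝ (Formal p V) _ * f.1 x) = 0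
    rw [← Algebra.smul_def, map_sub, map_smul, Formal.coeff_one, if_pos rfl,
      Formal.coeff_zero_eq, ← map_one (algebraMap ℝ (Sym p V)), Algebra.smul_def, ← map_mul,
      inv_mul_cancel₀ (hf x), sub_self]
  let g : smoothFormalFunctions n M p V U := ⟨_, isSmooth_geom h.2⟩
  have h1 : (1 - h) * g = 1 := Subtype.ext (funext fun x => Formal.one_sub_mul_geom (h0 x))
  have h2 : g * (1 - h) = 1 := Subtype.ext (funext fun x => Formal.geom_mul_one_sub (h0 x))
  have h3 : 1 - h = a * f := sub_sub_cancel 1 (a * f)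
  rw [h3] at h1 h2
  have hu : IsUnit (a * f) := ⟨⟨a * f, g, h1, h2⟩, rfl⟩
  have hb : IsUnit b := ⟨⟨b, a, hba, hab⟩, rfl⟩
  have := hb.mul hu
  rwa [← mul_assoc, hba, one_mul] at this

/-- The point of the stalk of `O` at `x` given by a morphism `O → C^∞`. -/
def BodyMap.pointEval {O : GradedRingedSpace.{u, w} I M} (ε : BodyMap n O) (x : M) :
    PointEval O x where
  ev U hx :=
    { toFun := fun f => ε.val f x hx
      map_one' := congrArg (fun g : smoothFunctions n M U => g.1 ⟨x, hx⟩) (map_one (ε.app U))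
      map_mul' := fun f g =>
        congrArg (fun g : smoothFunctions n M U => g.1 ⟨x, hx⟩) (map_mul (ε.app U) f g)
      map_zero' := congrArg (fun g : smoothFunctions n M U => g.1 ⟨x, hx⟩) (map_zero (ε.app U))
      map_add' := fun f g =>
        congrArg (fun g : smoothFunctions n M U => g.1 ⟨x, hx⟩) (map_add (ε.app U) f g) }
  ev_res {U _} h hx f :=
    congrArg (fun g : smoothFunctions n M U => g.1 ⟨x, hx⟩) (ε.naturality h f)

/-- The body of a section is continuous, so it stays non-zero on a neighbourhood of `x`, and there
the section is a unit. -/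
theorem canonicalBody_isLocal (p : I →+ ZMod 2) (V : GradedVectorSpace.{u, v} I) (x : M) :
    ((canonicalBody n M p V).pointEval x).IsLocal := by
  intro U hx f hf
  have hf' : IsSmooth n (show smoothFormalFunctions n M p V U from f).1 :=
    (show smoothFormalFunctions n M p V U from f).2
  let b : U → ℝ := fun y => Formal.body p V ((show smoothFormalFunctions n M p V U from f).1 y)
  have hb : Continuous b := (isSmooth_body hf').continuous
  have ho : IsOpen (b ⁻¹' {0}ᶜ) := isOpen_compl_singleton.preimage hb
  let W : Opens M := openImage U ⟨_, ho⟩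
  have hW : W ≤ U := fun y hy => (mem_openImage.mp hy).1
  refine ⟨W, hW, mem_openImage.mpr ⟨hx, hf⟩, ?_⟩
  exact isUnit_smoothFormalFunctions (U := W) _ fun y => (mem_openImage.mp y.2).2

theorem BodyMap.ext_of_isLocal {O : GradedRingedSpace.{u, w} I M} {ε : BodyMap n O}
    (hε : ∀ x, (ε.pointEval x).IsLocal) (ε' : BodyMap n O) : ε' = ε :=
  BodyMap.ext (funext fun U => RingHom.ext fun f => Subtype.ext (funext fun x =>
    (hε x.1).ev_eq (ε'.pointEval x.1) U x.2 f))

/-- The value of `ε` at `x`, pushed forward through the chart, is a real point of a graded domain,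
and the canonical body is the only one. -/
theorem BodyMap.isCanonical (p : I →+ ZMod 2) (V : GradedVectorSpace.{u, v} I)
    {O : GradedRingedSpace.{u, w} I M} (ε : BodyMap n O) : ε.IsCanonical p V :=
  fun c W g x hx => (canonicalBody_isLocal p V (c.map.base x)).ev_eq
    ((ε.pointEval x.1).restrict.map c.map) W hx g

end Body

/-! ### The body map of a graded manifold -/

section Existence

variable {n : ℕ} {M : Type u₁} [TopologicalSpace M] [ChartedSpace (EuclideanSpace ℝ (Fin n)) M]
  {p : I →+ ZMod 2} {V : GradedVectorSpace.{u, v} I} {O : GradedRingedSpace.{u, w} I M}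

theorem IsGradedManifold.exists_pointEval (hO : IsGradedManifold (n := n) p V O) (x : M) :
    ∃ e : PointEval O x, e.IsLocal := by
  obtain ⟨c, hx⟩ := hO x
  obtain ⟨e, he⟩ := PointEval.exists_isLocal_of_isIso c.isIso (x := ⟨x, hx⟩)
    (canonicalBody_isLocal p V _)
  exact PointEval.exists_isLocal_of_restrict he

/-- The image in the chart `c` of the part of the open set `U` in the domain of `c`. -/
theorem GradedChart.exists_target (c : GradedChart (n := n) p V O) (U : Opens M) :
    ∃ T : Opens c.target, ∀ x : c.source, c.map.base x ∈ T ↔ x.1 ∈ U := by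
  let h := c.isIso.isHomeomorph.homeomorph
  have hh : ∀ x, h.symm (c.map.base x) = x := h.symm_apply_apply
  refine ⟨⟨_, (U.isOpen.preimage continuous_subtype_val).preimage h.symm.continuous⟩, fun x => ?_⟩
  change (h.symm (c.map.base x)).1 ∈ U ↔ _
  rw [hh]

theorem GradedChart.openImage_le (c : GradedChart (n := n) p V O) {U : Opens M}
    {T : Opens c.target} (hT : ∀ x : c.source, c.map.base x ∈ T ↔ x.1 ∈ U) :
    openImage c.source (Opens.comap c.map.base T) ≤ U := fun x hx => by
  obtain ⟨h, hx⟩ := mem_openImage.mp hx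
  exact (hT ⟨x, h⟩).mp hx

/-- Every real point is computed in a chart by the body of the local representative `g`. Smooth
dependence on `x` and vanishing in non-zero degrees are both read off from this. -/
theorem GradedChart.ev_eq (c : GradedChart (n := n) p V O) {x : c.source} (e : PointEval O x.1)
    {U : Opens M} (hxU : x.1 ∈ U) (f : O.sec U) {T : Opens c.target}
    (hT : ∀ x : c.source, c.map.base x ∈ T ↔ x.1 ∈ U) {g : (gradedDomain p V c.target).sec T}
    (hg : c.map.app T g = O.res (c.openImage_le hT) f) :
    e.ev U hxU f = (canonicalBody n c.target p V).val g (c.map.base x) ((hT x).mpr hxU) := by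
  have h1 := (canonicalBody_isLocal p V (c.map.base x)).ev_eq (e.restrict.map c.map) T
    ((hT x).mpr hxU) g
  rw [← e.ev_res (c.openImage_le hT) (mem_openImage.mpr ⟨x.2, (hT x).mpr hxU⟩), ← hg]
  exact h1

theorem contMDiff_ev (hO : IsGradedManifold (n := n) p V O) (e : ∀ x, PointEval O x)
    (U : Opens M) (f : O.sec U) :
    ContMDiff (𝓡 n) 𝓘(ℝ, ℝ) ∞ fun x : U => (e x.1).ev U x.2 f := by
  refine contMDiff_of_locally _ fun x => ?_
  obtain ⟨c, hx⟩ := hO x.1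
  obtain ⟨T, hT⟩ := c.exists_target U
  obtain ⟨g, hg⟩ := (c.isIso.bijective T).2 (O.res (c.openImage_le hT) f)
  have hS : openImage c.source (Opens.comap c.map.base T) ≤ c.source := fun y hy =>
    (mem_openImage.mp hy).1
  -- The underlying map of the chart, with values in `T`; near `x` the function in question is the
  -- body of `g` composed with `β`.
  let β : openImage c.source (Opens.comap c.map.base T) → T := fun y =>
    ⟨c.map.base ⟨y.1, hS y.2⟩, (mem_openImage.mp y.2).2⟩
  have hβ : ContMDiff (𝓡 n) (𝓡 n) ∞ β := by
    rw [← ContMDiff.subtypeVal_comp_iff]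
    obtain ⟨d, hd⟩ := c.isDiffeo
    have := d.contMDiff.comp (contMDiff_inclusion (I := 𝓡 n) hS)
    rw [hd] at this
    exact this
  refine ⟨_, mem_openImage.mpr ⟨hx, (hT ⟨x.1, hx⟩).mpr x.2⟩, c.openImage_le hT, ?_⟩
  have h := ContMDiff.comp (I' := 𝓡 n)
    (show smoothFunctions n c.target T from (canonicalBody n c.target p V).app T g).2 hβ
  refine h.congr fun y => ?_
  exact c.ev_eq (x := ⟨y.1, hS y.2⟩) (e y.1) _ f hT hg

theorem IsGradedManifold.exists_bodyMap (hO : IsGradedManifold (n := n) p V O) :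
    ∃ ε : BodyMap n O, ∀ x, (ε.pointEval x).IsLocal := by
  classical
  choose e he using hO.exists_pointEval
  refine ⟨{ app := fun U =>
              { toFun := fun f => (⟨fun x => (e x.1).ev U x.2 f, contMDiff_ev hO e U f⟩ :
                  smoothFunctions n M U)
                map_one' := Subtype.ext (funext fun x => map_one ((e x.1).ev U x.2))
                map_mul' := fun f g => Subtype.ext (funext fun x => map_mul ((e x.1).ev U x.2) f g)
                map_zero' := Subtype.ext (funext fun x => map_zero ((e x.1).ev U x.2))
                map_add' := fun f g =>
                  Subtype.ext (funext fun x => map_add ((e x.1).ev U x.2) f g) }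
            naturality := fun h f => Subtype.ext (funext fun x => (e x.1).ev_res h x.2 f)
            app_mem := fun U i f hf => ?_ }, he⟩
  change _ ∈ (if i = 0 then ⊤ else ⊥ : Submodule ℝ (smoothFunctions n M U))
  by_cases hi : i = 0
  · rw [if_pos hi]
    trivial
  · rw [if_neg hi]
    refine (Submodule.mem_bot ℝ).mpr (Subtype.ext (funext fun x => ?_))
    obtain ⟨c, hx⟩ := hO x.1
    obtain ⟨T, hT⟩ := c.exists_target U
    obtain ⟨g, hg⟩ := (c.isIso.bijective T).2 (O.res (c.openImage_le hT) f)
    -- The chart reflects degrees, so the representative `g` has degree `i ≠ 0` too, and its body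
    -- vanishes because `S⁰(V)` lies in degree `0`.
    have hgi : g ∈ (gradedDomain p V c.target).grade T i := c.isIso.mem_of_app_mem T (by
      rw [hg]
      exact O.map_mem (c.openImage_le hT) hf)
    exact (c.ev_eq (x := ⟨x.1, hx⟩) (e x.1) x.2 f hT hg).trans (Formal.body_eq_zero hi (hgi _))

/-- Locally, smooth functions are bodies of sections that vanish where the functions do. -/
def BodyMap.Lifts (ε : BodyMap n O) : Prop :=
  ∀ x : M, ∃ W : Opens M, x ∈ W ∧ ∀ g : M → ℝ, ContMDiff (𝓡 n) 𝓘(ℝ, ℝ) ∞ g →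
    ∃ f : O.sec W, (∀ y (hy : y ∈ W), ε.val f y hy = g y) ∧
      ∀ (W' : Opens M) (h : W' ≤ W), (∀ y ∈ W', g y = 0) → O.res h f = 0

theorem canonicalBody_val_algebraMap {U : Opens M} {a : U → ℝ}
    (ha : ContMDiff (𝓡 n) 𝓘(ℝ, ℝ) ∞ a) {x : M} (hx : x ∈ U) :
    (canonicalBody n M p V).val (U := U)
      (⟨_, isSmooth_algebraMap ha⟩ : smoothFormalFunctions n M p V U) x hx = a ⟨x, hx⟩ := by
  change Formal.body p V (algebraMap ℝ _ (a ⟨x, hx⟩)) = _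
  rw [Formal.body_eq, Formal.coeff_algebraMap, if_pos rfl, AlgHom.commutes]
  rfl

/-- A smooth function is itself a section, with values in the scalars `S⁰(V)`. -/
theorem canonicalBody_lifts : (canonicalBody n M p V).Lifts := by
  refine fun x => ⟨⊤, trivial, fun g hg => ?_⟩
  have ha : ContMDiff (𝓡 n) 𝓘(ℝ, ℝ) ∞ fun y : (⊤ : Opens M) => g y.1 :=
    hg.comp contMDiff_subtype_val
  refine ⟨(⟨_, isSmooth_algebraMap ha⟩ : smoothFormalFunctions n M p V ⊤),
    fun y hy => canonicalBody_val_algebraMap ha hy, fun W' h h0 => ?_⟩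
  refine Subtype.ext (funext fun y => ?_)
  change algebraMap ℝ (Formal p V) (g y.1) = 0
  rw [h0 y.1 y.2, map_zero]

theorem IsGradedManifold.lifts (hO : IsGradedManifold (n := n) p V O) (ε : BodyMap n O) :
    ε.Lifts := by
  intro x
  obtain ⟨c, hx⟩ := hO x
  obtain ⟨d, hd⟩ := c.isDiffeo
  have hds : ∀ y, d.symm (c.map.base y) = y := fun y => by
    rw [← hd]
    exact d.symm_apply_apply y
  have hS : openImage c.source (Opens.comap c.map.base ⊤) ≤ c.source := fun y hy =>
    (mem_openImage.mp hy).1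
  refine ⟨openImage c.source (Opens.comap c.map.base ⊤), mem_openImage.mpr ⟨hx, trivial⟩,
    fun g hg => ?_⟩
  have ha : ContMDiff (𝓡 n) 𝓘(ℝ, ℝ) ∞
      fun y : (⊤ : Opens c.target) => g (d.symm y.1).1 :=
    hg.comp (contMDiff_subtype_val.comp (d.symm.contMDiff.comp contMDiff_subtype_val))
  let s : (gradedDomain p V c.target).sec ⊤ :=
    (⟨_, isSmooth_algebraMap ha⟩ : smoothFormalFunctions n c.target p V ⊤)
  refine ⟨c.map.app ⊤ s, fun y hy => ?_, fun W' h h0 => ?_⟩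
  · refine (ε.isCanonical p V c ⊤ s ⟨y, hS hy⟩ trivial).trans
      ((canonicalBody_val_algebraMap ha _).trans ?_)
    change g (d.symm (c.map.base ⟨y, hS hy⟩)).1 = _
    rw [hds]
  -- In the chart, the lift vanishes over the image `T` of `W'`; naturality of the chart pulls this
  -- back to `W'`.
  · obtain ⟨T, hT⟩ := c.exists_target W'
    have hW' : W' ≤ openImage c.source (Opens.comap c.map.base T) := fun y hy =>
      mem_openImage.mpr ⟨hS (h hy), (hT ⟨y, hS (h hy)⟩).mpr hy⟩
    have h1 : (gradedDomain p V c.target).res (le_top : T ≤ ⊤) s = 0 := by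
      refine Subtype.ext (funext fun y => ?_)
      change algebraMap ℝ (Formal p V) (g (d.symm y.1).1) = 0
      rw [h0, map_zero]
      refine (hT (d.symm y.1)).mp ?_
      rw [← hd, d.apply_symm_apply]
      exact y.2
    have h2 := c.map.naturality (le_top : T ≤ ⊤) s
    rw [h1, map_zero] at h2
    refine Eq.trans ?_ ((congrArg (O.res hW') h2.symm).trans (map_zero (O.res hW')))
    exact (O.res_res hW' _ (c.map.app ⊤ s)).symm

end Existence

/-! ### Morphisms and body maps -/

section Morphisms

variable {m n : ℕ} {M : Type u₁} [TopologicalSpace M] [ChartedSpace (EuclideanSpace ℝ (Fin m)) M]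
  {N : Type u₂} [TopologicalSpace N] [ChartedSpace (EuclideanSpace ℝ (Fin n)) N]
  {O₁ : GradedRingedSpace.{u, w₁} I M} {O₂ : GradedRingedSpace.{u, w₂} I N}
  {ε₁ : BodyMap m O₁} {ε₂ : BodyMap n O₂}

/-- Both sides, as functions of `f`, are real points of the stalk at `φ.base x`, and there is only
one. -/
theorem BodyMap.val_app (hε₂ : ∀ y, (ε₂.pointEval y).IsLocal) (φ : Hom O₁ O₂) (U : Opens N)
    (f : O₂.sec U) (x : M) (hx : φ.base x ∈ U) :
    ε₁.val (φ.app U f) x hx = ε₂.val f (φ.base x) hx :=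
  (hε₂ (φ.base x)).ev_eq ((ε₁.pointEval x).map φ) U hx f

theorem BodyMap.contMDiffAt_val (ε : BodyMap m O₁) {U : Opens M} (f : O₁.sec U) {g : M → ℝ}
    (hg : ∀ y (hy : y ∈ U), ε.val f y hy = g y) {x : M} (hx : x ∈ U) :
    ContMDiffAt (𝓡 m) 𝓘(ℝ, ℝ) ∞ g x := by
  have h : ContMDiff (𝓡 m) 𝓘(ℝ, ℝ) ∞ (show smoothFunctions m M U from ε.app U f).1 :=
    (show smoothFunctions m M U from ε.app U f).2
  have h' : (show smoothFunctions m M U from ε.app U f).1 = fun y : U => g y :=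
    funext fun y => hg y.1 y.2
  rw [h'] at h
  exact (contMDiffAt_subtype_iff (x := ⟨x, hx⟩)).mp (h ⟨x, hx⟩)

/-- Near `x` the composite is the body of the pullback of a local lift of `g`, and bodies are
smooth. -/
theorem BodyMap.contMDiff_comp (hε₂ : ∀ y, (ε₂.pointEval y).IsLocal) (hl : ε₂.Lifts)
    (ε₁ : BodyMap m O₁) (φ : Hom O₁ O₂) {g : N → ℝ} (hg : ContMDiff (𝓡 n) 𝓘(ℝ, ℝ) ∞ g) :
    ContMDiff (𝓡 m) 𝓘(ℝ, ℝ) ∞ fun x => g (φ.base x) := by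
  intro x
  obtain ⟨W, hW, h⟩ := hl (φ.base x)
  obtain ⟨f, hf, -⟩ := h g hg
  exact ε₁.contMDiffAt_val (φ.app W f) (fun y hy => (val_app hε₂ φ W f y hy).trans (hf _ hy)) hW

/-- Local coordinates at `φ x` become global smooth functions once multiplied by a bump function,
for which `N` has to be Hausdorff. Continuity of `φ` keeps nearby points where the bump function is
`1`. -/
theorem contMDiff_of_comp [T2Space N] [IsManifold (𝓡 n) ∞ N] (φ : C(M, N))
    (h : ∀ g : N → ℝ, ContMDiff (𝓡 n) 𝓘(ℝ, ℝ) ∞ g →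
      ContMDiff (𝓡 m) 𝓘(ℝ, ℝ) ∞ fun x => g (φ x)) : ContMDiff (𝓡 m) (𝓡 n) ∞ φ := by
  intro x
  rw [contMDiffAt_iff_target]
  refine ⟨φ.continuous.continuousAt, ?_⟩
  obtain ⟨b, -⟩ := (SmoothBumpFunction.nhds_basis_tsupport (I := 𝓡 n) (φ x)).ex_mem
  let L := EuclideanSpace.equiv (Fin n) ℝ
  have hb : ContMDiff (𝓡 n) 𝓘(ℝ, EuclideanSpace ℝ (Fin n)) ∞
      fun y => b y • extChartAt (𝓡 n) (φ x) y :=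
    b.contMDiff_smul contMDiffOn_extChartAt
  -- The hypothesis concerns real-valued functions, so the cut-off chart is split into its
  -- components and reassembled through `L`.
  have hL : ContMDiff (𝓡 m) 𝓘(ℝ, EuclideanSpace ℝ (Fin n)) ∞
      fun y => L.symm fun j => L (b (φ y) • extChartAt (𝓡 n) (φ x) (φ y)) j :=
    L.symm.contDiff.contMDiff.comp (contMDiff_pi_space.mpr fun j =>
      h (fun y => L (b y • extChartAt (𝓡 n) (φ x) y) j)
        (((ContinuousLinearMap.proj (R := ℝ) (φ := fun _ : Fin n => ℝ) j).comp
          (L : EuclideanSpace ℝ (Fin n) →L[ℝ] Fin n → ℝ)).contDiff.contMDiff.comp hb))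
  refine (hL x).congr_of_eventuallyEq ?_
  filter_upwards [φ.continuous.continuousAt.eventually b.eventuallyEq_one] with y hy
  have hy' : b (φ y) = 1 := hy
  rw [hy', one_smul]
  exact (L.symm_apply_apply _).symm

theorem BodyMap.contMDiff_base [T2Space N] [IsManifold (𝓡 n) ∞ N]
    (hε₂ : ∀ y, (ε₂.pointEval y).IsLocal) (hl : ε₂.Lifts) (ε₁ : BodyMap m O₁)
    (φ : Hom O₁ O₂) : ContMDiff (𝓡 m) (𝓡 n) ∞ φ.base :=
  contMDiff_of_comp φ.base fun _ hg => contMDiff_comp hε₂ hl ε₁ φ hg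

theorem BodyMap.comp_embedding (hε₂ : ∀ y, (ε₂.pointEval y).IsLocal) (φ : Hom O₁ O₂)
    (hφ : ContMDiff (𝓡 m) (𝓡 n) ∞ φ.base) :
    φ.comp ε₁.embedding = ε₂.embedding.comp (smoothHom φ.base hφ) :=
  Hom.ext rfl (heq_of_eq (funext fun U => RingHom.ext fun f => Subtype.ext (funext fun x =>
    val_app hε₂ φ U f x.1 x.2)))

/-- A bump function at `y` supported in `W` away from `z` is lifted over `W` and extended by zero.
The extension needs the lift itself, not just its body, to vanish off the support; the second clause
of `BodyMap.Lifts` provides this. -/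
theorem BodyMap.Lifts.exists_global [T2Space N] [IsManifold (𝓡 n) ∞ N] (hl : ε₂.Lifts)
    {y z : N} (hyz : y ≠ z) :
    ∃ f : O₂.sec ⊤, ε₂.val f y trivial = 1 ∧ ε₂.val f z trivial = 0 := by
  obtain ⟨W, hyW, hW⟩ := hl y
  obtain ⟨b, -, hb⟩ := (SmoothBumpFunction.nhds_basis_tsupport (I := 𝓡 n) y).mem_iff.mp
    ((W.isOpen.inter isOpen_compl_singleton).mem_nhds ⟨hyW, hyz⟩)
  obtain ⟨f, hf, hf0⟩ := hW b b.contMDiff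
  let K : Opens N := ⟨_, (isClosed_tsupport b).isOpen_compl⟩
  have hK : ∀ x ∈ K, b x = 0 := fun x hx => image_eq_zero_of_notMem_tsupport hx
  -- `W` contains the support of `b` and `K` is its complement, so the two cover `N`.
  obtain ⟨s, hs, hs'⟩ := O₂.exists_glue (U := W) (V := K) (eq_top_iff.mpr fun x _ => by
      by_cases hx : x ∈ tsupport b
      exacts [Or.inl (hb hx).1, Or.inr hx]) f 0 (by
    rw [map_zero]
    exact hf0 _ _ fun x hx => hK x hx.2)
  refine ⟨s, ?_, ?_⟩
  · refine ((ε₂.pointEval y).ev_res le_top hyW s).symm.trans ?_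
    rw [hs]
    exact (hf y hyW).trans b.eq_one
  · have hz : z ∈ K := fun hz => (hb hz).2 rfl
    refine ((ε₂.pointEval z).ev_res le_top hz s).symm.trans ?_
    rw [hs', map_zero]

/-- If `φ.base x ≠ ψ.base x`, a global section with body `1` at the first point and `0` at the
second would have a common pullback whose body at `x` is both `1` and `0`. -/
theorem BodyMap.base_eq [T2Space N] [IsManifold (𝓡 n) ∞ N]
    (hε₂ : ∀ y, (ε₂.pointEval y).IsLocal) (hl : ε₂.Lifts) (ε₁ : BodyMap m O₁)
    {φ ψ : Hom O₁ O₂} (h : φ.globalPullback = ψ.globalPullback) : φ.base = ψ.base := by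
  refine ContinuousMap.ext fun x => by_contra fun hne => ?_
  obtain ⟨f, hf1, hf0⟩ := hl.exists_global hne
  have h1 := val_app (ε₁ := ε₁) hε₂ φ ⊤ f x trivial
  have h2 := val_app (ε₁ := ε₁) hε₂ ψ ⊤ f x trivial
  have h3 : φ.globalPullback f = ψ.globalPullback f := RingHom.congr_fun h f
  have h4 : ε₁.val (U := ⊤) (φ.globalPullback f) x trivial =
    ε₁.val (U := ⊤) (ψ.globalPullback f) x trivial := by rw [h3]
  exact one_ne_zero (hf1.symm.trans (h1.symm.trans (h4.trans (h2.trans hf0))))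

end Morphisms

end MonoidallyGraded

end

/-! ### The proposition for graded manifolds and for graded domains. -/

open MonoidallyGraded GradedRingedSpace TopologicalSpace
open scoped Manifold ContDiff

theorem mainTheorem5 {I : Type*} [NonUnitalCommSemiring I] [IsCancelAdd I] [Countable I]
    (p : I →+ ZMod 2) (hp : p ≠ 0) {m n : ℕ}
    (V : GradedVectorSpace I) (W : GradedVectorSpace I)
    {M : Type*} [TopologicalSpace M] [T2Space M] [ChartedSpace (EuclideanSpace ℝ (Fin m)) M]
    [IsManifold (𝓡 m) ∞ M]
    {N : Type*} [TopologicalSpace N] [T2Space N] [ChartedSpace (EuclideanSpace ℝ (Fin n)) N]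
    [IsManifold (𝓡 n) ∞ N]
    (𝓜 : GradedRingedSpace I M) (h𝓜 : IsGradedManifold (n := m) p V 𝓜)
    (𝓝 : GradedRingedSpace I N) (h𝓝 : IsGradedManifold (n := n) p W 𝓝) :
    -- graded manifolds
    (∃ (εM : BodyMap m 𝓜) (εN : BodyMap n 𝓝),
      (εM.IsCanonical p V ∧ ∀ ε : BodyMap m 𝓜, ε = εM) ∧
      (εN.IsCanonical p W ∧ ∀ ε : BodyMap n 𝓝, ε = εN) ∧
      (∀ φ : Hom 𝓜 𝓝,
        (∀ (U : Opens N) (f : 𝓝.sec U) (x : M) (hx : φ.base x ∈ U),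
          εM.val (φ.app U f) x hx = εN.val f (φ.base x) hx) ∧
        ∃ hφ : ContMDiff (𝓡 m) (𝓡 n) ∞ φ.base,
          φ.comp εM.embedding = εN.embedding.comp (smoothHom φ.base hφ)) ∧
      ∀ φ ψ : Hom 𝓜 𝓝, φ.globalPullback = ψ.globalPullback → φ.base = ψ.base) ∧
    -- graded domains, with their canonical body maps
    ∀ (D : Opens (EuclideanSpace ℝ (Fin m))) (E : Opens (EuclideanSpace ℝ (Fin n))),
      (∀ φ : Hom (gradedDomain p V D) (gradedDomain p W E),
        (∀ (U : Opens E) (f : (gradedDomain p W E).sec U) (x : D) (hx : φ.base x ∈ U),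
          (canonicalBody m D p V).val (φ.app U f) x hx =
            (canonicalBody n E p W).val f (φ.base x) hx) ∧
        ∃ hφ : ContMDiff (𝓡 m) (𝓡 n) ∞ φ.base,
          φ.comp (canonicalBody m D p V).embedding =
            (canonicalBody n E p W).embedding.comp (smoothHom φ.base hφ)) ∧
      ∀ φ ψ : Hom (gradedDomain p V D) (gradedDomain p W E),
        φ.globalPullback = ψ.globalPullback → φ.base = ψ.base := by
  constructor
  · obtain ⟨εM, hM⟩ := h𝓜.exists_bodyMap
    obtain ⟨εN, hN⟩ := h𝓝.exists_bodyMap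
    have hl := h𝓝.lifts εN
    exact ⟨εM, εN, ⟨εM.isCanonical p V, BodyMap.ext_of_isLocal hM⟩,
      ⟨εN.isCanonical p W, BodyMap.ext_of_isLocal hN⟩,
      fun φ => ⟨BodyMap.val_app hN φ, BodyMap.contMDiff_base hN hl εM φ,
        BodyMap.comp_embedding hN φ _⟩,
      fun φ ψ => BodyMap.base_eq hN hl εM⟩
  · intro D E
    have hE := canonicalBody_isLocal (n := n) (M := E) p W
    exact ⟨fun φ => ⟨BodyMap.val_app hE φ,
        BodyMap.contMDiff_base hE canonicalBody_lifts (canonicalBody m D p V) φ,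
        BodyMap.comp_embedding hE φ _⟩,
      fun φ ψ => BodyMap.base_eq hE canonicalBody_lifts (canonicalBody m D p V)⟩
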